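/- A Markov decision process (MDP) $\mathcal G$ consists of a finite set $V$ of states, a transition relation in which every state has at least one outgoing transition, and a partition of $V$ into states controlled by a single player and random states; each random state carries a fixed probability distribution on its outgoing transitions. The MDP is either maximizing or minimizing. A reward function is a map $r : V \to \{-1,0,1\}$. A strategy $\sigma$ assigns to each history $w(0)\cdots w(n)\in V^+$ ending in a controlled state a probability distribution on the outgoing transitions of $w(n)$; it is memoryless if this distribution depends only on $w(n)$. A run is an infinite path in the transition graph, and $\mathbb P^\sigma_s$ is the induced probability measure on runs started in the state $s$. Consider the objectives $$\mathit{Mean}_{>0}=\Big\{w \;\Big|\; \liminf_{n\to\infty} \tfrac1n\sum_{i=0}^{n-1} r(w(i))>0\Big\},\qquad \mathit{LimInf}_{=+\infty}=\Big\{w \;\Big|\; \liminf_{n\to\infty}\sum_{i=0}^{n} r(w(i))=+\infty\Big\},$$ where $w$ ranges over runs. For an objective $O$, the value $\mathit{Val}^O(s)$ is $\sup_\sigma \mathbb P^\sigma_s(O)$ if $\mathcal G$ is maximizing and $\inf_\sigma \mathbb P^\sigma_s(O)$ if it is minimizing, where $\sigma$ ranges over all strategies. A strategy $\sigma$ is optimal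 in $s$ for $O$ if $\mathbb P^\sigma_s(O)=\mathit{Val}^O(s)$, and optimal if it is optimal in every state. **Lemma.** Let $\mathcal G$ be a (maximizing or minimizing) MDP with a reward function. 1. For every state $s$ and every memoryless strategy $\sigma$, $\mathbb P^\sigma_s(\mathit{Mean}_{>0})=\mathbb P^\sigma_s(\mathit{LimInf}_{=+\infty})$. 2. For every state $s$, $\mathit{Val}^{\mathit{Mean}_{>0}}(s)=\mathit{Val}^{\mathit{LimInf}_{=+\infty}}(s)$. 3. A memoryless strategy is optimal in a state $s$ (respectively, optimal) for $\mathit{Mean}_{>0}$ if and only if it is optimal in $s$ (respectively, optimal) for $\mathit{LimInf}_{=+\infty}$. Moreover, for arbitrary strategies: if $\mathcal G$ is maximizing, every strategy that is optimal in $s$ for $\mathit{Mean}_{>0}$ is optimal in $s$ for $\mathit{LimInf}_{=+\infty}$; if $\mathcal G$ is minimizing, every strategy that is optimal in $s$ for $\mathit{LimInf}_{=+\infty}$ is optimal in $s$ for $\mathit{Mean}_{>0}$. -/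

import Mathlib

open MeasureTheory ProbabilityTheory Filter

/-- The unique player of a Markov decision process: `max` in a maximizing MDP, `min` in a
minimizing MDP. -/
inductive Player where
  | max
  | min

/-- A Markov decision process on the set of states `V`. The states in `controlled` belong to the
unique player, all the other states are random. -/
structure MDP (V : Type*) where
  /-- whether the MDP is maximizing or minimizing -/
  player : Player
  /-- the transition relation -/
  edge : V → V → Prop
  /-- every state has an outgoing transition -/
  exists_edge : ∀ v, ∃ u, edge v u
  /-- the states that belong to the player -/
  controlled : Set V
  /-- the probability assignment of the random states -/
  prob : ∀ v, v ∉ controlled → PMF V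
  /-- the distribution of a random state is a distribution on its outgoing transitions -/
  edge_of_mem_support : ∀ v hv, ∀ u ∈ (prob v hv).support, edge v u

/-- The histories `w(0) ⋯ w(n)`, that is, the words of length `n + 1` over `V`. -/
abbrev History (V : Type*) (n : ℕ) := Finset.Iic n → V

/-- The last state `w(n)` of a history `w(0) ⋯ w(n)`. -/
def History.last {V : Type*} {n : ℕ} (w : History V n) : V :=
  w ⟨n, Finset.mem_Iic.2 le_rfl⟩

namespace MDP

/-- A (history dependent, randomized) strategy: it assigns to each history that ends in a state
of the player a probability distribution on the outgoing transitions of that state. -/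
structure Strategy {V : Type*} (G : MDP V) where
  /-- the distribution of the next state -/
  act : ∀ (n : ℕ) (w : History V n), w.last ∈ G.controlled → PMF V
  /-- only outgoing transitions are chosen -/
  edge_of_mem_support : ∀ n w hw, ∀ u ∈ (act n w hw).support, G.edge w.last u

/-- A strategy is memoryless if its choice depends only on the last state of the history. -/
def Strategy.Memoryless {V : Type*} {G : MDP V} (σ : G.Strategy) : Prop :=
  ∀ (m n : ℕ) (w : History V m) (w' : History V n)
    (hw : w.last ∈ G.controlled) (hw' : w'.last ∈ G.controlled),
    w.last = w'.last → σ.act m w hw = σ.act n w' hw'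

open Classical in
/-- The distribution of the state that follows the history `w` when `σ` is played. -/
noncomputable def next {V : Type*} (G : MDP V) (σ : G.Strategy) {n : ℕ} (w : History V n) :
    PMF V :=
  if h : w.last ∈ G.controlled then σ.act n w h else G.prob w.last h

/-- `MDP.next` as a Markov kernel from the histories of length `n + 1` to the states. -/
noncomputable def stepKernel {V : Type*} [Countable V] [MeasurableSpace V]
    [DiscreteMeasurableSpace V] (G : MDP V) (σ : G.Strategy) (n : ℕ) :
    Kernel (History V n) V where
  toFun w := (G.next σ w).toMeasure
  measurable' := Measurable.of_discrete

instance {V : Type*} [Countable V] [MeasurableSpace V] [DiscreteMeasurableSpace V] (G : MDP V)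
    (σ : G.Strategy) (n : ℕ) : IsMarkovKernel (G.stepKernel σ n) :=
  ⟨fun w => PMF.toMeasure.isProbabilityMeasure (G.next σ w)⟩

/-- The probability measure on infinite sequences of states that is obtained by starting in `s`
and playing `σ` (given by the Ionescu-Tulcea theorem). -/
noncomputable def pr {V : Type*} [Countable V] [MeasurableSpace V] [DiscreteMeasurableSpace V]
    (G : MDP V) (σ : G.Strategy) (s : V) : Measure (ℕ → V) :=
  Kernel.traj (X := fun _ => V) (G.stepKernel σ) 0 (fun _ => s)

/-- The runs of `G`: the infinite paths in its transition graph. -/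
def runs {V : Type*} (G : MDP V) : Set (ℕ → V) :=
  {w | ∀ i, G.edge (w i) (w (i + 1))}

/-- The objective that the liminf of the accumulated reward is `+∞`. -/
def limInfEqTop {V : Type*} (G : MDP V) (r : V → ℤ) : Set (ℕ → V) :=
  {w ∈ G.runs |
    liminf (fun n : ℕ => ((∑ i ∈ Finset.range (n + 1), (r (w i) : ℝ) : ℝ) : EReal)) atTop = ⊤}

/-- The objective that the liminf of the mean payoff is positive. -/
def meanPos {V : Type*} (G : MDP V) (r : V → ℤ) : Set (ℕ → V) :=
  {w ∈ G.runs |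
    0 < liminf (fun n : ℕ => (((∑ i ∈ Finset.range n, (r (w i) : ℝ)) / n : ℝ) : EReal)) atTop}

/-- The value of the state `s` for the objective `O`, over all strategies. -/
noncomputable def val {V : Type*} [Countable V] [MeasurableSpace V] [DiscreteMeasurableSpace V]
    (G : MDP V) (O : Set (ℕ → V)) (s : V) : ENNReal :=
  match G.player with
  | .max => ⨆ σ : G.Strategy, G.pr σ s O
  | .min => ⨅ σ : G.Strategy, G.pr σ s O

/-- The strategy `σ` is optimal in `s` for the objective `O`. -/
def IsOptimalIn {V : Type*} [Countable V] [MeasurableSpace V] [DiscreteMeasurableSpace V]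
    (G : MDP V) (O : Set (ℕ → V)) (σ : G.Strategy) (s : V) : Prop :=
  match G.player with
  | .max => G.val O s ≤ G.pr σ s O
  | .min => G.pr σ s O ≤ G.val O s

/-- The strategy `σ` is optimal for the objective `O`: it is optimal in every state. -/
def IsOptimal {V : Type*} [Countable V] [MeasurableSpace V] [DiscreteMeasurableSpace V]
    (G : MDP V) (O : Set (ℕ → V)) (σ : G.Strategy) : Prop :=
  ∀ s, G.IsOptimalIn O σ s

end MDP

open scoped Topology
set_option linter.unusedSectionVars false

/-! ### One-step conditional expectations, the path measure, and the two objectives -/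

namespace MDP

variable {V : Type*} [Fintype V] (G : MDP V) (σ : G.Strategy) (s : V)

/-! Linear growth of the accumulated reward implies divergence, so `meanPos` is contained in
`limInfEqTop`. What remains is that no strategy attains `limInfEqTop` with more than the supremal
probability of `meanPos` (`pr_limInfEqTop_le_supVal`), and that the same holds for the complements
with the roles exchanged (`pr_compl_meanPos_le_supVal`).

In either case let `v` be the supremal value of the target objective. It is superharmonic under
every strategy, since one may move once and then play almost optimally. So `v` along a run is a
bounded supermartingale with finitely many values; it is eventually constant, and the limit is `1`
with probability at most `v s` (`pr_le_of_superharmonic`). It remains to rule out runs that stay in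
a level `c < 1`.

Farkas' lemma on the edges leaving that level leaves two cases. A potential `H` may correct the
reward to a drift of one sign: martingale convergence then excludes divergence to `+∞`, or a
Chernoff bound yields a positive mean. Otherwise there is a circulation whose reward has the wrong
sign. With its support reduced, it becomes a memoryless policy on a closed set, where duality
applies again and the target objective holds almost surely. Then `v = 1` at a state of level `c`, a
contradiction.

A memoryless strategy induces a Markov chain, an MDP without choices, so the first inequality
already gives equality there. -/

/-- The expectation of `f` at the state that follows the history `w`. -/
noncomputable def nextExp {n : ℕ} (w : History V n) (f : V → ℝ) : ℝ :=
  ∑ u, (G.next σ w u).toReal * f u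

theorem sum_toReal_eq_one (p : PMF V) : ∑ u, (p u).toReal = 1 := by
  rw [← ENNReal.toReal_sum fun u _ => p.apply_ne_top u, ← tsum_fintype (L := .unconditional _),
    p.tsum_coe, ENNReal.toReal_one]

theorem nextExp_const {n : ℕ} (h : History V n) (c : ℝ) : G.nextExp σ h (fun _ => c) = c := by
  rw [nextExp, ← Finset.sum_mul, sum_toReal_eq_one, one_mul]

theorem nextExp_add {n : ℕ} (h : History V n) (f g : V → ℝ) :
    G.nextExp σ h (fun u => f u + g u) = G.nextExp σ h f + G.nextExp σ h g := by
  simp only [nextExp, mul_add, Finset.sum_add_distrib]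

theorem nextExp_const_mul {n : ℕ} (h : History V n) (c : ℝ) (f : V → ℝ) :
    G.nextExp σ h (fun u => c * f u) = c * G.nextExp σ h f := by
  simp only [nextExp, Finset.mul_sum]
  exact Finset.sum_congr rfl fun u _ => by ring

theorem nextExp_mono {n : ℕ} (h : History V n) {f g : V → ℝ} (hfg : ∀ u, f u ≤ g u) :
    G.nextExp σ h f ≤ G.nextExp σ h g :=
  Finset.sum_le_sum fun u _ => mul_le_mul_of_nonneg_left (hfg u) ENNReal.toReal_nonneg

variable [MeasurableSpace V] [DiscreteMeasurableSpace V]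

instance : IsProbabilityMeasure (G.pr σ s) := by unfold pr; infer_instance

theorem integrable_of_history {n : ℕ} (F : History V n → ℝ) (μ : Measure (ℕ → V))
    [IsFiniteMeasure μ] : Integrable (fun w => F (Preorder.frestrictLe n w)) μ := by
  obtain ⟨C, hC⟩ := (Set.finite_range fun h => ‖F h‖).bddAbove
  exact Integrable.of_bound
    ((Measurable.of_discrete (f := F)).comp
      (Preorder.measurable_frestrictLe n)).aestronglyMeasurable C
    (ae_of_all _ fun w => hC ⟨_, rfl⟩)

theorem integral_toMeasure (p : PMF V) (f : V → ℝ) :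
    ∫ u, f u ∂p.toMeasure = ∑ u, (p u).toReal * f u := by
  rw [PMF.integral_eq_sum]; rfl

/-- The trajectory kernel started at `h₀` freezes the coordinates up to `n`, and its marginal at `n
+ 1` is the step kernel. -/
theorem integral_traj_step {n : ℕ} (h₀ : History V n) (F : History V n → V → ℝ) :
    ∫ w, F (Preorder.frestrictLe n w) (w (n + 1))
      ∂Kernel.traj (X := fun _ => V) (G.stepKernel σ) n h₀ = G.nextExp σ h₀ (F h₀) := by
  have hmeas : Measurable fun w : ℕ → V => F (Preorder.frestrictLe n w) (w (n + 1)) :=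
    Measurable.comp (g := fun h : History V n × V => F h.1 h.2)
      (f := fun w : ℕ → V => (Preorder.frestrictLe n w, w (n + 1))) Measurable.of_discrete
      ((Preorder.measurable_frestrictLe n).prodMk (measurable_pi_apply (n + 1)))
  rw [Kernel.integral_traj h₀ hmeas.aestronglyMeasurable]
  have h1 : ∀ x : ℕ → V,
      Preorder.frestrictLe (π := fun _ => V) n (Function.updateFinset x (Finset.Iic n) h₀) =
        h₀ := fun x => by
    ext i
    simp [Function.updateFinset]
  have h2 : ∀ x : ℕ → V, Function.updateFinset x (Finset.Iic n) h₀ (n + 1) = x (n + 1) :=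
    fun x => by simp [Function.updateFinset]
  simp only [h1, h2]
  have hm : (Kernel.traj (X := fun _ => V) (G.stepKernel σ) n h₀).map
      (fun x : ℕ → V => x (n + 1)) = (G.next σ h₀).toMeasure := by
    rw [← Kernel.map_apply _ (measurable_pi_apply _), Kernel.map_traj_succ_self]
    rfl
  rw [nextExp, ← integral_toMeasure, ← hm, integral_map (measurable_pi_apply _).aemeasurable
    Measurable.of_discrete.aestronglyMeasurable]

theorem integrable_step {n : ℕ} (F : History V n → V → ℝ) :
    Integrable (fun w : ℕ → V => F (Preorder.frestrictLe n w) (w (n + 1))) (G.pr σ s) :=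
  integrable_of_history (n := n + 1)
    (fun h : History V (n + 1) =>
      F (Preorder.frestrictLe₂ (π := fun _ => V) n.le_succ h) h.last) (G.pr σ s)

/-- Tower property: condition on the history up to time `n`. -/
theorem integral_step {n : ℕ} (F : History V n → V → ℝ) :
    ∫ w, F (Preorder.frestrictLe n w) (w (n + 1)) ∂G.pr σ s =
      ∫ w, G.nextExp σ (Preorder.frestrictLe n w) (F (Preorder.frestrictLe n w)) ∂G.pr σ s := by
  have h := Kernel.integral_traj_partialTraj (κ := G.stepKernel σ) (X := fun _ => V)
    (Nat.zero_le n) (G.integrable_step σ s F)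
  simp only [integral_traj_step] at h
  unfold pr
  rw [← h, ← Kernel.traj_map_frestrictLe_apply, integral_map
    (Preorder.measurable_frestrictLe n).aemeasurable
    (Measurable.of_discrete.aestronglyMeasurable)]

/-- The indicator of the failure of `P` has conditional expectation zero. -/
theorem ae_step {n : ℕ} (P : History V n → V → Prop)
    (hP : ∀ h u, G.next σ h u ≠ 0 → P h u) :
    ∀ᵐ w ∂G.pr σ s, P (Preorder.frestrictLe n w) (w (n + 1)) := by
  classical
  have h := G.integral_step σ s fun (h : History V n) u => if P h u then (0 : ℝ) else 1
  have h0 : ∀ h : History V n, G.nextExp σ h (fun u => if P h u then (0 : ℝ) else 1) = 0 := by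
    intro h
    refine Finset.sum_eq_zero fun u _ => ?_
    by_cases hu : G.next σ h u = 0
    · simp [hu]
    · simp [hP h u hu]
  simp only [h0, integral_zero] at h
  rw [integral_eq_zero_iff_of_nonneg (fun w => by dsimp only; split_ifs <;> simp)
    (G.integrable_step σ s fun h u => if P h u then (0 : ℝ) else 1)] at h
  filter_upwards [h] with w hw
  by_contra hc
  simp [hc] at hw

theorem ae_zero : ∀ᵐ w ∂G.pr σ s, w 0 = s := by
  have h : (G.pr σ s).map (Preorder.frestrictLe 0) = Measure.dirac (fun _ => s) := by
    rw [pr, Kernel.traj_map_frestrictLe_apply, Kernel.partialTraj_self, Kernel.id_apply]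
  have h1 : ∀ᵐ x ∂(G.pr σ s).map (Preorder.frestrictLe (π := fun _ => V) 0),
      x ⟨0, by simp⟩ = s := by
    rw [h, ae_dirac_eq]
    simp
  exact ae_of_ae_map (Preorder.measurable_frestrictLe 0).aemeasurable h1

theorem edge_of_next_ne_zero {V : Type*} (G : MDP V) (σ : G.Strategy) {n : ℕ} (h : History V n)
    (u : V) (hu : G.next σ h u ≠ 0) : G.edge h.last u := by
  unfold next at hu
  split_ifs at hu with hc
  · exact σ.edge_of_mem_support n h hc u hu
  · exact G.edge_of_mem_support _ hc u hu

theorem ae_mem_runs : ∀ᵐ w ∂G.pr σ s, w ∈ G.runs :=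
  ae_all_iff.2 fun n => G.ae_step σ s (fun (h : History V n) u => G.edge h.last u)
    (G.edge_of_next_ne_zero σ)

theorem mem_limInfEqTop {V : Type*} (G : MDP V) (r : V → ℤ) (w : ℕ → V) :
    w ∈ G.limInfEqTop r ↔
      w ∈ G.runs ∧ Tendsto (fun n => ∑ i ∈ Finset.range n, (r (w i) : ℝ)) atTop atTop := by
  refine and_congr_right fun _ => ?_
  rw [← tendsto_add_atTop_iff_nat (f := fun n => ∑ i ∈ Finset.range n, (r (w i) : ℝ)) 1,
    ← EReal.tendsto_coe_nhds_top_iff]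
  exact ⟨fun h => tendsto_of_le_liminf_of_limsup_le h.ge le_top, fun h => h.liminf_eq⟩

theorem mem_meanPos {V : Type*} (G : MDP V) (r : V → ℤ) (w : ℕ → V) :
    w ∈ G.meanPos r ↔
      w ∈ G.runs ∧ ∃ c : ℝ, 0 < c ∧
        ∀ᶠ n : ℕ in atTop, c * n ≤ ∑ i ∈ Finset.range n, (r (w i) : ℝ) := by
  refine and_congr_right fun _ => ⟨fun h => ?_, fun ⟨c, hc, h⟩ => ?_⟩
  · obtain ⟨c, hc0, hc⟩ := EReal.lt_iff_exists_real_btwn.1 h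
    refine ⟨c, by exact_mod_cast hc0, ?_⟩
    -- The index `0`, where the quotient is the default value `0`, is discarded before the
    -- denominator is cleared.
    filter_upwards [eventually_lt_of_lt_liminf hc, eventually_gt_atTop 0] with n hn hn0
    have hn0' : (0 : ℝ) < n := by exact_mod_cast hn0
    exact ((lt_div_iff₀ hn0').1 (EReal.coe_lt_coe_iff.1 hn)).le
  · refine lt_of_lt_of_le (EReal.coe_pos.2 hc) (le_liminf_of_le (by isBoundedDefault) ?_)
    filter_upwards [h, eventually_gt_atTop 0] with n hn hn0
    have hn0' : (0 : ℝ) < n := by exact_mod_cast hn0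
    exact EReal.coe_le_coe_iff.2 ((le_div_iff₀ hn0').2 hn)

theorem meanPos_subset_limInfEqTop {V : Type*} (G : MDP V) (r : V → ℤ) :
    G.meanPos r ⊆ G.limInfEqTop r := by
  intro w hw
  rw [mem_meanPos] at hw
  obtain ⟨hw, c, hc, h⟩ := hw
  exact (G.mem_limInfEqTop r w).2 ⟨hw, tendsto_atTop_mono' _ h
    (tendsto_natCast_atTop_atTop.const_mul_atTop hc)⟩

theorem measurableSet_runs : MeasurableSet G.runs := by
  have h : G.runs = ⋂ i : ℕ, (fun w : ℕ → V => (w i, w (i + 1))) ⁻¹'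
      {x : V × V | G.edge x.1 x.2} := by
    ext w
    simp [runs]
  rw [h]
  exact MeasurableSet.iInter fun i =>
    ((measurable_pi_apply i).prodMk (measurable_pi_apply (i + 1))) MeasurableSet.of_discrete

theorem measurable_sum_reward (r : V → ℤ) (n : ℕ) :
    Measurable fun w : ℕ → V => ∑ i ∈ Finset.range n, (r (w i) : ℝ) :=
  Finset.measurable_sum _ fun i _ =>
    (Measurable.of_discrete (f := fun v : V => (r v : ℝ))).comp (measurable_pi_apply i)

theorem measurableSet_limInfEqTop (r : V → ℤ) : MeasurableSet (G.limInfEqTop r) :=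
  G.measurableSet_runs.inter (measurableSet_eq_fun
    (.liminf fun n => (measurable_sum_reward r (n + 1)).coe_real_ereal) measurable_const)

theorem measurableSet_meanPos (r : V → ℤ) : MeasurableSet (G.meanPos r) :=
  G.measurableSet_runs.inter (measurableSet_lt measurable_const
    (.liminf fun n => ((measurable_sum_reward r n).div_const _).coe_real_ereal))

end MDP

/-! ### Processes with bounded increments: convergence and linear growth -/

namespace MDP
variable {V : Type*} [Fintype V] [MeasurableSpace V] [DiscreteMeasurableSpace V]
  (G : MDP V) (σ : G.Strategy) (s : V)

/-- The accumulated increments `D` along a history. -/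
def cumul {V : Type*} (D : ∀ n, History V n → V → ℝ) : ∀ n, History V n → ℝ
  | 0, _ => 0
  | n + 1, h => cumul D n (Preorder.frestrictLe₂ (π := fun _ => V) n.le_succ h) +
      D n (Preorder.frestrictLe₂ (π := fun _ => V) n.le_succ h) h.last

/-- The accumulated increments `D` along an infinite sequence of states. -/
def cumulPath {V : Type*} (D : ∀ n, History V n → V → ℝ) (n : ℕ) (w : ℕ → V) : ℝ :=
  cumul D n (Preorder.frestrictLe n w)

theorem cumulPath_zero {V : Type*} (D : ∀ n, History V n → V → ℝ) (w : ℕ → V) :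
    cumulPath D 0 w = 0 := rfl

theorem cumulPath_succ {V : Type*} (D : ∀ n, History V n → V → ℝ) (n : ℕ) (w : ℕ → V) :
    cumulPath D (n + 1) w = cumulPath D n w + D n (Preorder.frestrictLe n w) (w (n + 1)) := rfl

theorem integrable_cumulPath (D : ∀ n, History V n → V → ℝ) (n : ℕ) (μ : Measure (ℕ → V))
    [IsFiniteMeasure μ] : Integrable (cumulPath D n) μ :=
  integrable_of_history (cumul D n) μ

theorem submartingale_cumulPath {D : ∀ n, History V n → V → ℝ}
    (hD : ∀ n h, 0 ≤ G.nextExp σ h (D n h)) :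
    Submartingale (cumulPath D) (Filtration.piLE (X := fun _ : ℕ => V)) (G.pr σ s) := by
  refine submartingale_of_setIntegral_le_succ (fun n => ?_)
    (fun n => integrable_cumulPath D n _) fun n A hA => ?_
  · rw [Filtration.piLE_eq_comap_frestrictLe]
    exact ((Measurable.of_discrete (f := cumul D n)).comp
      (comap_measurable (Preorder.frestrictLe (π := fun _ : ℕ => V) n))).stronglyMeasurable
  · have hA' := (Filtration.piLE (X := fun _ : ℕ => V)).le n A hA
    rw [Filtration.piLE_eq_comap_frestrictLe] at hA
    obtain ⟨t, -, rfl⟩ := hA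
    simp only [cumulPath_succ]
    rw [integral_add (integrable_cumulPath D n _).integrableOn
      (G.integrable_step σ s (D n)).integrableOn]
    refine le_add_of_nonneg_right ?_
    rw [← integral_indicator hA']
    classical
    -- The event depends only on the history up to `n`, so its indicator can be absorbed into the
    -- increment.
    have h := G.integral_step σ s fun (h : History V n) u => (if h ∈ t then 1 else 0) * D n h u
    have h1 : (fun w : ℕ → V => (if Preorder.frestrictLe n w ∈ t then 1 else 0) *
        D n (Preorder.frestrictLe n w) (w (n + 1))) =
        (Preorder.frestrictLe n ⁻¹' t).indicator
          fun w => D n (Preorder.frestrictLe n w) (w (n + 1)) := by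
      funext w
      simp [Set.indicator_apply]
    rw [← h1, h]
    refine integral_nonneg fun w => ?_
    simp only [nextExp_const_mul]
    exact mul_nonneg (by split_ifs <;> simp) (hD _ _)

theorem ae_tendsto_cumulPath {D : ∀ n, History V n → V → ℝ}
    (hD : ∀ n h, 0 ≤ G.nextExp σ h (D n h)) {R : ℝ} (hR : ∀ n h u, |D n h u| ≤ R) :
    ∀ᵐ w ∂G.pr σ s, BddAbove (Set.range fun n => cumulPath D n w) →
      ∃ c, Tendsto (fun n => cumulPath D n w) atTop (𝓝 c) := by
  have hR' : ∀ n h u, |D n h u| ≤ R.toNNReal := fun n h u => (hR n h u).trans (le_max_left _ _)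
  filter_upwards [(G.submartingale_cumulPath σ s hD).bddAbove_iff_exists_tendsto
    (R := R.toNNReal) (ae_of_all _ fun w n => by
      rw [cumulPath_succ, add_sub_cancel_left]; exact hR' _ _ _)] with w hw using hw.1

/-- Conditionally on the past, each new increment contributes a factor of at most `q`. -/
theorem integral_exp_cumulPath_le {D : ∀ n, History V n → V → ℝ} {l q : ℝ} (hq : 0 ≤ q)
    (hD : ∀ n h, G.nextExp σ h (fun u => Real.exp (-l * D n h u)) ≤ q) (n : ℕ) :
    ∫ w, Real.exp (-l * cumulPath D n w) ∂G.pr σ s ≤ q ^ n := by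
  induction n with
  | zero => simp [cumulPath_zero]
  | succ n ih =>
    have h := G.integral_step σ s fun (h : History V n) u =>
      Real.exp (-l * cumul D n h) * Real.exp (-l * D n h u)
    simp only [nextExp_const_mul] at h
    calc ∫ w, Real.exp (-l * cumulPath D (n + 1) w) ∂G.pr σ s
        = ∫ w, Real.exp (-l * cumul D n (Preorder.frestrictLe n w)) *
            G.nextExp σ (Preorder.frestrictLe n w)
              (fun u => Real.exp (-l * D n (Preorder.frestrictLe n w) u)) ∂G.pr σ s := by
          rw [← h]
          simp only [cumulPath_succ, mul_add, Real.exp_add]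
          rfl
      _ ≤ ∫ w, Real.exp (-l * cumul D n (Preorder.frestrictLe n w)) * q ∂G.pr σ s := by
          refine integral_mono
            (integrable_of_history (fun h : History V n => Real.exp (-l * cumul D n h) *
              G.nextExp σ h (fun u => Real.exp (-l * D n h u))) _)
            (integrable_of_history (fun h : History V n => Real.exp (-l * cumul D n h) * q) _)
            fun w => mul_le_mul_of_nonneg_left (hD _ _) (Real.exp_pos _).le
      _ ≤ q ^ (n + 1) := by
          rw [integral_mul_const, pow_succ]
          exact mul_le_mul_of_nonneg_right ih hq

/-- Chernoff bound followed by Borel–Cantelli. -/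
theorem ae_eventually_le_cumulPath {D : ∀ n, History V n → V → ℝ} {d R : ℝ} (hd : 0 < d)
    (hD : ∀ n h, d ≤ G.nextExp σ h (D n h)) (hR : ∀ n h u, |D n h u| ≤ R) :
    ∀ᵐ w ∂G.pr σ s, ∀ᶠ n : ℕ in atTop, d / 4 * n ≤ cumulPath D n w := by
  have hdR : d ≤ R := by
    have h := G.nextExp_mono σ (fun _ : Finset.Iic 0 => s) (f := D 0 fun _ => s) (g := fun _ => R)
      fun u => (le_abs_self _).trans (hR _ _ _)
    rw [nextExp_const] at h
    exact (hD _ _).trans h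
  have hR0 : 0 < R := hd.trans_le hdR
  -- With this `l` the quadratic error `l² R²` is half of the linear gain `l d`, and `l R ≤ 1/2`
  -- permits the estimate `exp x ≤ 1 + x + x²`.
  set l : ℝ := d / (2 * R ^ 2) with hl
  have hl0 : 0 < l := by positivity
  have hlR : l * R ≤ 1 / 2 := by
    rw [hl, div_mul_eq_mul_div, div_le_div_iff₀ (by positivity) (by norm_num)]
    nlinarith
  have hlR2 : l ^ 2 * R ^ 2 = l * d / 2 := by
    rw [hl]; field_simp
  have key : ∀ n h, G.nextExp σ h (fun u => Real.exp (-l * D n h u)) ≤ Real.exp (-(l * d / 2)) := by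
    intro n h
    calc G.nextExp σ h (fun u => Real.exp (-l * D n h u))
        ≤ G.nextExp σ h (fun u => (1 + l * d / 2) + -l * D n h u) := by
          refine G.nextExp_mono σ h fun u => ?_
          have h1 : |(-l * D n h u)| ≤ l * R := by
            rw [abs_mul, abs_neg, abs_of_pos hl0]
            exact mul_le_mul_of_nonneg_left (hR n h u) hl0.le
          have h2 := (abs_le.1 (Real.abs_exp_sub_one_sub_id_le (h1.trans (by linarith)))).2
          have h3 : (-l * D n h u) ^ 2 ≤ (l * R) ^ 2 := sq_le_sq' (abs_le.1 h1).1 (abs_le.1 h1).2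
          rw [mul_pow l R, hlR2] at h3
          linarith
      _ = (1 + l * d / 2) + -l * G.nextExp σ h (D n h) := by
          rw [nextExp_add, nextExp_const, nextExp_const_mul]
      _ ≤ -(l * d / 2) + 1 := by nlinarith [hD n h]
      _ ≤ _ := Real.add_one_le_exp _
  have hint := G.integral_exp_cumulPath_le σ s (Real.exp_pos _).le key
  set ρ : ℝ := Real.exp (-(l * d / 4)) with hρ
  have hρ1 : ρ < 1 := by
    rw [hρ, Real.exp_lt_one_iff]
    have : 0 < l * d := by positivity
    linarith
  -- The exponential moment is at most `ρ ^ (2 n)` and the threshold is `ρ ^ n`, so Markov's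
  -- inequality leaves the summable bound `ρ ^ n`.
  have hprob : ∀ n : ℕ, G.pr σ s {w | cumulPath D n w < d / 4 * n} ≤ ENNReal.ofReal (ρ ^ n) := by
    intro n
    have hm := mul_meas_ge_le_integral_of_nonneg (μ := G.pr σ s)
      (f := fun w => Real.exp (-l * cumulPath D n w)) (ae_of_all _ fun w => (Real.exp_pos _).le)
      (integrable_of_history (fun h : History V n => Real.exp (-l * cumul D n h)) _)
      (Real.exp (-(l * d / 4)) ^ n)
    rw [← hρ] at hm
    have hρ2 : Real.exp (-(l * d / 2)) = ρ * ρ := by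
      rw [hρ, ← Real.exp_add]; congr 1; ring
    have hρn : 0 < ρ ^ n := pow_pos (Real.exp_pos _) n
    have h2 := hm.trans (hint n)
    rw [hρ2, mul_pow] at h2
    have h3 := le_of_mul_le_mul_left h2 hρn
    rw [← ENNReal.ofReal_le_ofReal_iff hρn.le, measureReal_def,
      ENNReal.ofReal_toReal (measure_ne_top _ _)] at h3
    refine le_trans (measure_mono fun w hw => ?_) h3
    simp only [Set.mem_ofPred_eq] at hw ⊢
    rw [hρ, ← Real.exp_nat_mul, Real.exp_le_exp]
    nlinarith
  have hsum : ∑' n : ℕ, G.pr σ s {w | cumulPath D n w < d / 4 * n} ≠ ⊤ :=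
    ne_top_of_le_ne_top
      (summable_geometric_of_lt_one (Real.exp_pos _).le hρ1).tsum_ofReal_ne_top
      (ENNReal.tsum_le_tsum hprob)
  filter_upwards [ae_eventually_notMem hsum] with w hw
  filter_upwards [hw] with n hn using not_lt.1 hn

end MDP

/-! ### Superharmonic functions and potentials as bounds on probabilities -/

namespace MDP
variable {V : Type*} [Fintype V] [MeasurableSpace V] [DiscreteMeasurableSpace V]
  (G : MDP V) (σ : G.Strategy) (s : V)

theorem cumulPath_sub (v : V → ℝ) (n : ℕ) (w : ℕ → V) :
    cumulPath (fun _ h u => v h.last - v u) n w = v (w 0) - v (w n) := by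
  induction n with
  | zero => simp [cumulPath_zero]
  | succ n ih =>
    rw [cumulPath_succ, ih]
    simp [History.last]

theorem exists_abs_le (v : V → ℝ) : ∃ C, 0 ≤ C ∧ ∀ u, |v u| ≤ C := by
  refine ⟨∑ u, |v u|, Finset.sum_nonneg fun u _ => abs_nonneg _, fun u => ?_⟩
  exact Finset.single_le_sum (f := fun u => |v u|) (fun u _ => abs_nonneg _) (Finset.mem_univ u)

/-- The process `v (w 0) - v (w n)` is a bounded submartingale, so it converges; as `v` has finitely
many values, convergence means being eventually constant. -/
theorem ae_eventually_const {v : V → ℝ}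
    (hv : ∀ n (h : History V n), G.nextExp σ h v ≤ v h.last) :
    ∀ᵐ w ∂G.pr σ s, ∃ c N, ∀ n, N ≤ n → v (w n) = c := by
  obtain ⟨C, -, hC⟩ := exists_abs_le v
  filter_upwards [G.ae_tendsto_cumulPath σ s (D := fun _ h u => v h.last - v u) (R := C + C)
    (fun n h => by
      have := G.nextExp_add σ h (fun _ => v h.last) (fun u => -1 * v u)
      simp only [nextExp_const, nextExp_const_mul] at this
      simp only [sub_eq_add_neg, ← neg_one_mul (v _)]
      rw [this]
      linarith [hv n h])
    (fun n h u => (abs_sub _ _).trans (add_le_add (hC _) (hC _)))] with w hw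
  simp only [cumulPath_sub] at hw
  obtain ⟨c, hc⟩ := hw ⟨C + C, by
    rintro _ ⟨n, rfl⟩
    exact (le_abs_self _).trans ((abs_sub _ _).trans (add_le_add (hC _) (hC _)))⟩
  have hlim : Tendsto (fun n => v (w n)) atTop (𝓝 (v (w 0) - c)) := by
    simpa using hc.const_sub (v (w 0))
  have hfin : (Set.range v \ {v (w 0) - c}).Finite := (Set.finite_range v).subset Set.sdiff_subset
  have hnhds : (Set.range v \ {v (w 0) - c})ᶜ ∈ 𝓝 (v (w 0) - c) :=
    hfin.isClosed.isOpen_compl.mem_nhds (by simp)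
  obtain ⟨N, hN⟩ := eventually_atTop.1 (hlim hnhds)
  refine ⟨v (w 0) - c, N, fun n hn => ?_⟩
  by_contra hne
  exact hN n hn ⟨⟨_, rfl⟩, hne⟩

theorem integral_value_le {v : V → ℝ}
    (hv : ∀ n (h : History V n), G.nextExp σ h v ≤ v h.last) (n : ℕ) :
    ∫ w, v (w n) ∂G.pr σ s ≤ v s := by
  induction n with
  | zero =>
    have : ∫ w, v (w 0) ∂G.pr σ s = ∫ _, v s ∂G.pr σ s :=
      integral_congr_ae (by filter_upwards [G.ae_zero σ s] with w hw; rw [hw])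
    rw [this]
    simp
  | succ n ih =>
    refine le_trans ?_ ih
    have h := G.integral_step σ s fun (_ : History V n) u => v u
    rw [h]
    exact integral_mono (integrable_of_history (fun h : History V n => G.nextExp σ h v) _)
      (integrable_of_history (fun h : History V n => v h.last) _) fun w => hv n _

/-- If `v` does not increase in expectation along the runs, and almost no run in `B` eventually
stays in a level of `v` below `1`, then `v` bounds the probability of `B`. -/
theorem pr_le_of_superharmonic {v : V → ℝ} (hv0 : ∀ u, 0 ≤ v u) (hv1 : ∀ u, v u ≤ 1)
    (hv : ∀ n (h : History V n), G.nextExp σ h v ≤ v h.last) {B : Set (ℕ → V)}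
    (hB : ∀ c < 1, ∀ N, ∀ᵐ w ∂G.pr σ s, (∀ n, N ≤ n → v (w n) = c) → w ∉ B) :
    G.pr σ s B ≤ ENNReal.ofReal (v s) := by
  -- Levels are indexed by states instead of reals, so that only countably many null sets are
  -- united.
  have hB' : ∀ u N, v u < 1 → ∀ᵐ w ∂G.pr σ s, (∀ n, N ≤ n → v (w n) = v u) → w ∉ B :=
    fun u N hu => hB _ hu N
  have hB'' : ∀ᵐ w ∂G.pr σ s, ∀ u N, v u < 1 → (∀ n, N ≤ n → v (w n) = v u) → w ∉ B := by
    simp only [ae_all_iff]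
    exact fun u N => hB' u N
  have hsub : G.pr σ s B ≤ G.pr σ s (⋃ N, {w | ∀ n, N ≤ n → v (w n) = 1}) := by
    refine measure_mono_ae ?_
    filter_upwards [hB'', G.ae_eventually_const σ s hv] with w h1 ⟨c, N, h2⟩ hw
    refine Set.mem_iUnion.2 ⟨N, fun n hn => ?_⟩
    have hc : v (w N) = c := h2 N le_rfl
    by_contra hne
    have hlt : v (w N) < 1 := lt_of_le_of_ne (hv1 _) (by rw [hc, ← h2 n hn]; exact hne)
    exact h1 (w N) N hlt (fun n hn => by rw [h2 n hn, hc]) hw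
  refine hsub.trans ?_
  -- By continuity from below it suffices to treat each `N`, where Markov's inequality at threshold
  -- `1` is applied to `v (w N)`, whose mean is at most `v s`.
  have hmono : Monotone fun N : ℕ => {w : ℕ → V | ∀ n, N ≤ n → v (w n) = 1} :=
    fun N M hNM w hw n hn => hw n (hNM.trans hn)
  rw [hmono.measure_iUnion]
  refine iSup_le fun N => ?_
  have hm := mul_meas_ge_le_integral_of_nonneg (μ := G.pr σ s)
    (f := fun w => v (w N)) (ae_of_all _ fun w => hv0 _)
    (integrable_of_history (fun h : History V N => v h.last) _) 1
  rw [one_mul] at hm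
  have h3 := hm.trans (G.integral_value_le σ s hv N)
  rw [← ENNReal.ofReal_le_ofReal_iff (hv0 s), measureReal_def,
    ENNReal.ofReal_toReal (measure_ne_top _ _)] at h3
  exact (measure_mono fun w hw => (hw N le_rfl).ge).trans h3

open Classical in
/-- The increments of the reward corrected by the potential `H`, as long as `v` is constantly `c`
from time `N` on; the constant `d` otherwise. -/
noncomputable def gated (r : V → ℤ) (v H : V → ℝ) (c d : ℝ) (N n : ℕ) (h : History V n) (u : V) :
    ℝ :=
  if N ≤ n ∧ ∀ i : Finset.Iic n, N ≤ i.1 → v (h i) = c then (r h.last + H u) - H h.last else d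

/-- While the gate is open the current state lies in level `c` and `hH` applies; otherwise the
increment is `d` itself. Thus a drift bound known only on the level holds for all histories. -/
theorem le_nextExp_gated {r : V → ℤ} {v H : V → ℝ} {c d : ℝ} (N : ℕ)
    (hH : ∀ n (h : History V n), v h.last = c → d ≤ r h.last + G.nextExp σ h H - H h.last) (n : ℕ)
    (h : History V n) : d ≤ G.nextExp σ h (gated r v H c d N n h) := by
  classical
  by_cases hc : N ≤ n ∧ ∀ i : Finset.Iic n, N ≤ i.1 → v (h i) = c
  · have h1 : gated r v H c d N n h = fun u => (r h.last - H h.last) + H u := by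
      funext u
      rw [gated, if_pos hc]
      ring
    rw [h1, nextExp_add, nextExp_const]
    linarith [hH n h (hc.2 _ hc.1)]
  · have h1 : gated r v H c d N n h = fun u => d := by
      funext u
      rw [gated, if_neg hc]
    rw [h1, nextExp_const]

theorem exists_abs_gated_le (r : V → ℤ) (v H : V → ℝ) (c d : ℝ) (N : ℕ) :
    ∃ R, ∀ n h u, |gated r v H c d N n h u| ≤ R := by
  obtain ⟨A, hA0, hA⟩ := exists_abs_le fun v => (r v : ℝ)
  obtain ⟨B, hB0, hB⟩ := exists_abs_le H
  refine ⟨A + B + B + |d|, fun n h u => ?_⟩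
  unfold gated
  have h1 := hA h.last
  have h2 := hB h.last
  have h3 := hB u
  have h4 := abs_nonneg d
  split_ifs
  · rw [abs_le] at *
    constructor <;> linarith
  · linarith

theorem cumulPath_gated {r : V → ℤ} {v H : V → ℝ} {c d : ℝ} {N : ℕ} {w : ℕ → V}
    (hw : ∀ n, N ≤ n → v (w n) = c) (n : ℕ) (hn : N ≤ n) :
    cumulPath (gated r v H c d N) n w =
      (∑ i ∈ Finset.range n, (r (w i) : ℝ)) + H (w n) + (cumulPath (gated r v H c d N) N w -
        (∑ i ∈ Finset.range N, (r (w i) : ℝ)) - H (w N)) := by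
  induction n, hn using Nat.le_induction with
  | base => ring
  | succ n hn ih =>
    rw [cumulPath_succ, ih, Finset.sum_range_succ, gated, if_pos ⟨hn, fun i hi => hw _ hi⟩]
    simp only [History.last, Preorder.frestrictLe_apply]
    ring

/-- An upper bound of the probability that the accumulated reward tends to infinity. -/
theorem pr_limInfEqTop_le {r : V → ℤ} {v : V → ℝ} (hv0 : ∀ u, 0 ≤ v u) (hv1 : ∀ u, v u ≤ 1)
    (hv : ∀ n (h : History V n), G.nextExp σ h v ≤ v h.last)
    (hH : ∀ c < 1, ∃ H : V → ℝ, ∀ n (h : History V n), v h.last = c →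
      r h.last + G.nextExp σ h H - H h.last ≤ 0) :
    G.pr σ s (G.limInfEqTop r) ≤ ENNReal.ofReal (v s) := by
  refine G.pr_le_of_superharmonic σ s hv0 hv1 hv fun c hc N => ?_
  obtain ⟨H, hH⟩ := hH c hc
  obtain ⟨C, -, hC⟩ := exists_abs_le H
  -- Negating reward and potential gives a submartingale. On a run of the objective that stays in
  -- the level it tends to `-∞`, hence is bounded above, hence would converge.
  have hH' : ∀ n (h : History V n), v h.last = c →
      0 ≤ ((-r h.last : ℤ) : ℝ) + G.nextExp σ h (fun u => -1 * H u) - -1 * H h.last := by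
    intro n h hc
    rw [nextExp_const_mul]
    push_cast
    linarith [hH n h hc]
  obtain ⟨R, hR⟩ := exists_abs_gated_le (fun u => -r u) v (fun u => -1 * H u) c 0 N
  filter_upwards [G.ae_tendsto_cumulPath σ s
    (G.le_nextExp_gated σ (r := fun u => -r u) (H := fun u => -1 * H u) (d := 0) N hH') hR]
    with w hw hconst hmem
  have hS := ((G.mem_limInfEqTop r w).1 hmem).2
  set X := fun n => cumulPath (gated (fun u => -r u) v (fun u => -1 * H u) c 0 N) n w with hX
  set K := X N - (∑ i ∈ Finset.range N, ((-r (w i) : ℤ) : ℝ)) - -1 * H (w N) with hK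
  have hbound : ∀ᶠ n in atTop, X n ≤ -(∑ i ∈ Finset.range n, (r (w i) : ℝ)) + (C + K) := by
    filter_upwards [eventually_ge_atTop N] with n hn
    have h1 : X n = _ := cumulPath_gated hconst n hn
    rw [h1]
    have h3 := (abs_le.1 (hC (w n))).1
    simp only [Int.cast_neg, Finset.sum_neg_distrib] at hK ⊢
    linarith
  have hlim : Tendsto X atTop atBot :=
    tendsto_atBot_mono' _ hbound
      (tendsto_atBot_add_const_right _ _ (tendsto_neg_atTop_atBot.comp hS))
  have hbdd : BddAbove (Set.range X) := by
    obtain ⟨M, hM⟩ := eventually_atTop.1 (hlim.eventually_le_atBot 0)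
    refine ⟨∑ i ∈ Finset.range M, |X i|, ?_⟩
    rintro _ ⟨n, rfl⟩
    rcases le_or_gt M n with h | h
    · exact (hM n h).trans (Finset.sum_nonneg fun i _ => abs_nonneg _)
    · exact (le_abs_self _).trans (Finset.single_le_sum (f := fun i => |X i|)
        (fun i _ => abs_nonneg _) (Finset.mem_range.2 h))
  obtain ⟨l, hl⟩ := hw hbdd
  exact not_tendsto_nhds_of_tendsto_atBot hlim l hl

/-- An upper bound of the probability that the mean payoff is not positive. -/
theorem pr_compl_meanPos_le {r : V → ℤ} {v : V → ℝ} (hv0 : ∀ u, 0 ≤ v u) (hv1 : ∀ u, v u ≤ 1)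
    (hv : ∀ n (h : History V n), G.nextExp σ h v ≤ v h.last)
    (hH : ∀ c < 1, ∃ H : V → ℝ, ∃ d > 0, ∀ n (h : History V n), v h.last = c →
      d ≤ r h.last + G.nextExp σ h H - H h.last) :
    G.pr σ s (G.meanPos r)ᶜ ≤ ENNReal.ofReal (v s) := by
  refine G.pr_le_of_superharmonic σ s hv0 hv1 hv fun c hc N => ?_
  obtain ⟨H, d, hd, hH⟩ := hH c hc
  obtain ⟨C, -, hC⟩ := exists_abs_le H
  obtain ⟨R, hR⟩ := exists_abs_gated_le r v H c d N
  filter_upwards [G.ae_eventually_le_cumulPath σ s hd (G.le_nextExp_gated σ N hH) hR,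
    G.ae_mem_runs σ s] with w hw hrun hconst
  rw [Set.notMem_compl_iff, mem_meanPos]
  -- Of the slope `d / 4`, half is spent on absorbing the bounded potential and the contribution of
  -- the times before `N`.
  refine ⟨hrun, d / 8, by positivity, ?_⟩
  set K := cumulPath (gated r v H c d N) N w -
        (∑ i ∈ Finset.range N, (r (w i) : ℝ)) - H (w N) with hK
  have hlarge : ∀ᶠ n : ℕ in atTop, C + K ≤ d / 8 * n :=
    (tendsto_natCast_atTop_atTop.const_mul_atTop (by positivity)).eventually_ge_atTop _
  filter_upwards [hw, hlarge, eventually_ge_atTop N] with n h1 h2 hn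
  rw [cumulPath_gated hconst n hn, ← hK] at h1
  have h3 := (abs_le.1 (hC (w n))).2
  linarith

end MDP

/-! ### First-step decomposition and independence of the first state -/

/-- The history without its first state. -/
def History.tail {V : Type*} {n : ℕ} (h : History V (n + 1)) : History V n :=
  fun i => h ⟨i.1 + 1, Finset.mem_Iic.2 (Nat.succ_le_succ (Finset.mem_Iic.1 i.2))⟩

/-- The first state of a history. -/
def History.first {V : Type*} {n : ℕ} (h : History V n) : V :=
  h ⟨0, Finset.mem_Iic.2 (Nat.zero_le n)⟩

open Classical in
/-- The history `h` followed by the state `u`. -/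
noncomputable def History.snoc {V : Type*} {n : ℕ} (h : History V n) (u : V) : History V (n + 1) :=
  fun i => if hi : i.1 ≤ n then h ⟨i.1, Finset.mem_Iic.2 hi⟩ else u

theorem History.snoc_frestrictLe {V : Type*} (n : ℕ) (w : ℕ → V) :
    History.snoc (Preorder.frestrictLe n w) (w (n + 1)) = Preorder.frestrictLe (n + 1) w := by
  funext ⟨i, hi⟩
  rw [Finset.mem_Iic] at hi
  unfold History.snoc
  split_ifs with h
  · rfl
  · obtain rfl : i = n + 1 := le_antisymm hi (Nat.lt_of_not_le h)
    rfl

namespace MDP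

/-- The strategy that moves from `s` to `a s` in the first step, and plays `τ u` from then on,
where `u` is the second state. -/
noncomputable def Strategy.delay {V : Type*} {G : MDP V} (a : V → V) (ha : ∀ s, G.edge s (a s))
    (τ : V → G.Strategy) : G.Strategy where
  act n h hh :=
    match n, h, hh with
    | 0, h, _ => PMF.pure (a h.last)
    | n + 1, h, hh => (τ h.tail.first).act n h.tail hh
  edge_of_mem_support n h hh u hu :=
    match n, h, hh, u, hu with
    | 0, h, _, u, hu => by
      rw [PMF.mem_support_pure_iff] at hu
      exact hu ▸ ha _
    | n + 1, h, hh, u, hu => (τ h.tail.first).edge_of_mem_support n h.tail hh u hu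

open Classical in
/-- The distribution of the next state when the edge to `u` is chosen in `s`; the choice has no
effect in a random state. -/
noncomputable def move {V : Type*} (G : MDP V) (s u : V) : PMF V :=
  if h : s ∈ G.controlled then PMF.pure u else G.prob s h

theorem next_delay_zero {V : Type*} {G : MDP V} (a : V → V) (ha : ∀ s, G.edge s (a s))
    (τ : V → G.Strategy) (h : History V 0) :
    G.next (Strategy.delay a ha τ) h = G.move h.last (a h.last) := rfl

theorem next_delay_succ {V : Type*} {G : MDP V} (a : V → V) (ha : ∀ s, G.edge s (a s))
    (τ : V → G.Strategy) {n : ℕ} (h : History V (n + 1)) :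
    G.next (Strategy.delay a ha τ) h = G.next (τ h.tail.first) h.tail := rfl

variable {V : Type*} [Fintype V] [MeasurableSpace V] [DiscreteMeasurableSpace V]
  (G : MDP V) (σ : G.Strategy) (s : V)

/-- Induction on the length of the shifted history: after the first move, the conditional law of
each further state is that of `τ t` started in the second state `t`, so both sides obey the same
recursion. -/
theorem integral_delay (a : V → V) (ha : ∀ s, G.edge s (a s)) (τ : V → G.Strategy) (n : ℕ)
    (f : History V n → ℝ) :
    ∫ w, f (Preorder.frestrictLe n fun i => w (i + 1)) ∂G.pr (Strategy.delay a ha τ) s =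
      ∑ t, (G.move s (a s) t).toReal * ∫ w, f (Preorder.frestrictLe n w) ∂G.pr (τ t) t := by
  induction n with
  | zero =>
    have h := G.integral_step (Strategy.delay a ha τ) s fun (_ : History V 0) u => f fun _ => u
    have h1 : ∀ w : ℕ → V, (Preorder.frestrictLe 0 fun i => w (i + 1)) = fun _ => w (0 + 1) := by
      intro w
      funext ⟨i, hi⟩
      obtain rfl : i = 0 := by simpa using hi
      rfl
    simp only [h1]
    rw [h]
    have h2 : ∀ t, ∫ w, f (Preorder.frestrictLe 0 w) ∂G.pr (τ t) t = f fun _ => t := by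
      intro t
      have : ∫ w, f (Preorder.frestrictLe 0 w) ∂G.pr (τ t) t =
          ∫ _, f (fun _ => t) ∂G.pr (τ t) t := by
        refine integral_congr_ae ?_
        filter_upwards [G.ae_zero (τ t) t] with w hw
        congr 1
        funext ⟨i, hi⟩
        obtain rfl : i = 0 := by simpa using hi
        exact hw
      rw [this]
      simp
    simp only [h2]
    have h3 : ∫ w, G.nextExp (Strategy.delay a ha τ) (Preorder.frestrictLe (π := fun _ => V) 0 w)
        (fun u => f fun _ => u) ∂G.pr (Strategy.delay a ha τ) s =
        ∫ _, ∑ t, (G.move s (a s) t).toReal * f (fun _ => t) ∂G.pr (Strategy.delay a ha τ) s := by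
      refine integral_congr_ae ?_
      filter_upwards [G.ae_zero (Strategy.delay a ha τ) s] with w hw
      rw [nextExp, next_delay_zero]
      simp only [History.last, Preorder.frestrictLe_apply, hw]
    rw [h3]
    simp
  | succ n ih =>
    have h := G.integral_step (Strategy.delay a ha τ) s
      fun (h : History V (n + 1)) u => f (h.tail.snoc u)
    have htail : ∀ w : ℕ → V, History.tail (Preorder.frestrictLe (n + 1) w) =
        Preorder.frestrictLe n fun i => w (i + 1) := fun w => rfl
    have hnext : ∀ (w : ℕ → V) (g : V → ℝ),
        G.nextExp (Strategy.delay a ha τ) (Preorder.frestrictLe (π := fun _ => V) (n + 1) w) g =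
          G.nextExp (τ (History.first (Preorder.frestrictLe n fun i => w (i + 1))))
            (Preorder.frestrictLe n fun i => w (i + 1)) g := fun w g => by
      rw [nextExp, nextExp, next_delay_succ, htail]
    have hsnoc : ∀ w : ℕ → V, Preorder.frestrictLe (n + 1) (fun i => w (i + 1)) =
        History.snoc (Preorder.frestrictLe n fun i => w (i + 1)) (w (n + 1 + 1)) := fun w => by
      rw [← History.snoc_frestrictLe]
    simp only [hnext, htail] at h
    simp only [hsnoc]
    -- Integrating out the last state turns `f` into a function of a history shorter by one.
    rw [h, ih fun h => G.nextExp (τ h.first) h fun u => f (h.snoc u)]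
    refine Finset.sum_congr rfl fun t _ => congrArg ((G.move s (a s) t).toReal * ·) ?_
    have h2 := G.integral_step (τ t) t fun (h : History V n) u => f (h.snoc u)
    simp only [History.snoc_frestrictLe] at h2
    rw [h2]
    refine integral_congr_ae ?_
    filter_upwards [G.ae_zero (τ t) t] with w hw
    simp only [History.first, Preorder.frestrictLe_apply, hw]

/-- Indicators of single histories determine all finite-dimensional marginals, and a finite measure
is the unique projective limit of its marginals. -/
theorem measure_ext_of_integral_history {μ ν : Measure (ℕ → V)} [IsFiniteMeasure μ]
    [IsFiniteMeasure ν] (h : ∀ n (f : History V n → ℝ),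
      ∫ w, f (Preorder.frestrictLe n w) ∂μ = ∫ w, f (Preorder.frestrictLe n w) ∂ν) : μ = ν := by
  classical
  have hmap : ∀ n, μ.map (Preorder.frestrictLe n) = ν.map (Preorder.frestrictLe n) := by
    intro n
    have := Measure.isFiniteMeasure_map μ (Preorder.frestrictLe (π := fun _ : ℕ => V) n)
    have := Measure.isFiniteMeasure_map ν (Preorder.frestrictLe (π := fun _ : ℕ => V) n)
    refine Measure.ext_of_singleton fun x => ?_
    have hx := h n (({x} : Set (History V n)).indicator fun _ => 1)
    have hm := Preorder.measurable_frestrictLe (X := fun _ : ℕ => V) n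
    rw [← integral_map hm.aemeasurable Measurable.of_discrete.aestronglyMeasurable,
      ← integral_map hm.aemeasurable Measurable.of_discrete.aestronglyMeasurable,
      integral_indicator_const _ (.of_discrete), integral_indicator_const _ (.of_discrete)] at hx
    simpa [measureReal_def, ENNReal.toReal_eq_toReal_iff'] using hx
  have hproj : IsProjectiveMeasureFamily fun I : Finset ℕ => ν.map I.restrict := by
    intro I J hJI
    dsimp only
    rw [Measure.map_map (by fun_prop) (by fun_prop)]
    rfl
  exact ((isProjectiveLimit_nat_iff hproj μ).2 hmap).unique fun I => rfl

theorem map_pr_delay (a : V → V) (ha : ∀ s, G.edge s (a s)) (τ : V → G.Strategy) :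
    (G.pr (Strategy.delay a ha τ) s).map (fun w i => w (i + 1)) =
      ∑ t, G.move s (a s) t • G.pr (τ t) t := by
  have hfin : ∀ t, IsFiniteMeasure (G.move s (a s) t • G.pr (τ t) t) := fun t =>
    Measure.smul_finite _ (PMF.apply_ne_top _ _)
  have hm : Measurable fun (w : ℕ → V) i => w (i + 1) :=
    measurable_pi_lambda _ fun i => measurable_pi_apply _
  have := Measure.isFiniteMeasure_map (G.pr (Strategy.delay a ha τ) s) fun (w : ℕ → V) i => w (i + 1)
  refine measure_ext_of_integral_history fun n f => ?_
  rw [integral_map hm.aemeasurable (integrable_of_history f _).aestronglyMeasurable,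
    integral_delay, integral_finsetSum_measure fun t _ => integrable_of_history f _]
  simp only [integral_smul_measure, smul_eq_mul]

/-- Playing one step and continuing with `τ` adds up the probabilities of an objective that does
not depend on the first state of a run. -/
theorem pr_delay (a : V → V) (ha : ∀ s, G.edge s (a s)) (τ : V → G.Strategy) {O : Set (ℕ → V)}
    (hO : MeasurableSet O)
    (hO' : ∀ w : ℕ → V, G.edge (w 0) (w 1) → (w ∈ O ↔ (fun i => w (i + 1)) ∈ O)) :
    G.pr (Strategy.delay a ha τ) s O = ∑ t, G.move s (a s) t * G.pr (τ t) t O := by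
  have h := congrArg (fun μ => μ O) (G.map_pr_delay s a ha τ)
  simp only [Measure.finsetSum_apply, Measure.smul_apply, smul_eq_mul] at h
  rw [← h, Measure.map_apply (measurable_pi_lambda _ fun i => measurable_pi_apply _) hO]
  refine measure_congr ?_
  filter_upwards [G.ae_mem_runs (Strategy.delay a ha τ) s] with w hw
  exact propext (hO' w (hw 0))

theorem tail_mem_runs_iff {V : Type*} (G : MDP V) {w : ℕ → V} (hw : G.edge (w 0) (w 1)) :
    w ∈ G.runs ↔ (fun i => w (i + 1)) ∈ G.runs :=
  ⟨fun h i => h (i + 1), fun h i => by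
    cases i with
    | zero => exact hw
    | succ i => exact h i⟩

theorem tail_mem_limInfEqTop_iff {V : Type*} (G : MDP V) (r : V → ℤ) {w : ℕ → V}
    (hw : G.edge (w 0) (w 1)) :
    w ∈ G.limInfEqTop r ↔ (fun i => w (i + 1)) ∈ G.limInfEqTop r := by
  rw [mem_limInfEqTop, mem_limInfEqTop, G.tail_mem_runs_iff hw,
    ← tendsto_add_atTop_iff_nat (f := fun n => ∑ i ∈ Finset.range n, (r (w i) : ℝ)) 1]
  simp only [Finset.sum_range_succ']
  refine and_congr_right fun _ => ⟨fun h => ?_, tendsto_atTop_add_const_right _ _⟩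
  simpa using tendsto_atTop_add_const_right _ (-(r (w 0) : ℝ)) h

/-- The shift alters the sum by one reward and the length by one; halving the slope absorbs both. -/
theorem tail_mem_meanPos_iff {V : Type*} (G : MDP V) (r : V → ℤ) {w : ℕ → V}
    (hw : G.edge (w 0) (w 1)) :
    w ∈ G.meanPos r ↔ (fun i => w (i + 1)) ∈ G.meanPos r := by
  have hlarge : ∀ (C : ℝ) {c : ℝ}, 0 < c → ∀ᶠ n : ℕ in atTop, C ≤ c * n := fun C c hc =>
    (tendsto_natCast_atTop_atTop.const_mul_atTop hc).eventually_ge_atTop C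
  rw [mem_meanPos, mem_meanPos, G.tail_mem_runs_iff hw]
  refine and_congr_right fun _ => ⟨fun ⟨c, hc, h⟩ => ⟨c / 2, half_pos hc, ?_⟩,
    fun ⟨c, hc, h⟩ => ⟨c / 2, half_pos hc, ?_⟩⟩
  · rw [← map_add_atTop_eq_nat 1, eventually_map] at h
    filter_upwards [h, hlarge (r (w 0)) (half_pos hc)] with n h1 h2
    rw [Finset.sum_range_succ'] at h1
    push_cast at h1
    linarith
  · rw [← map_add_atTop_eq_nat 1, eventually_map]
    filter_upwards [h, hlarge (c / 2 - r (w 0)) (half_pos hc)] with n h1 h2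
    rw [Finset.sum_range_succ']
    push_cast
    linarith

end MDP

/-! ### Linear duality and circulations -/

/-- **Farkas' lemma**: a linear form that is nonpositive wherever the forms `a i` are is a
nonnegative combination of them. -/
theorem exists_nonneg_combination {W ι : Type*} [AddCommGroup W] [Module ℝ W] (I : Finset ι)
    (a : ι → W →ₗ[ℝ] ℝ) (b : W →ₗ[ℝ] ℝ) (h : ∀ x, (∀ i ∈ I, a i x ≤ 0) → b x ≤ 0) :
    ∃ l : ι → ℝ, (∀ i, 0 ≤ l i) ∧ b = ∑ i ∈ I, l i • a i := by
  classical
  induction I using Finset.induction_on generalizing a b with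
  | empty =>
    refine ⟨0, fun _ => le_rfl, LinearMap.ext fun x => ?_⟩
    have h1 := h x (by simp)
    have h2 := h (-x) (by simp)
    rw [map_neg] at h2
    simp only [Finset.sum_empty, LinearMap.zero_apply]
    linarith
  | insert j I hj ih =>
    by_cases hI : ∀ x, (∀ i ∈ I, a i x ≤ 0) → b x ≤ 0
    · obtain ⟨l, hl, hb⟩ := ih a b hI
      refine ⟨Function.update l j 0, fun i => ?_, ?_⟩
      · by_cases hij : i = j
        · simp [hij]
        · simpa [hij] using hl i
      · rw [Finset.sum_insert hj, Function.update_self, zero_smul, zero_add, hb]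
        exact Finset.sum_congr rfl fun i hi => by
          rw [Function.update_of_ne (ne_of_mem_of_not_mem hi hj)]
    · push Not at hI
      obtain ⟨z, hz, hbz⟩ := hI
      have hjz : 0 < a j z := by
        by_contra hc
        refine absurd (h z fun i hi => ?_) (not_le.2 hbz)
        rcases Finset.mem_insert.1 hi with rfl | hi
        · exact not_lt.1 hc
        · exact hz i hi
      set x₀ := (a j z)⁻¹ • z with hx₀
      have hj1 : a j x₀ = 1 := by
        rw [hx₀, map_smul, smul_eq_mul, inv_mul_cancel₀ hjz.ne']
      have hax : ∀ i ∈ I, a i x₀ ≤ 0 := fun i hi => by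
        rw [hx₀, map_smul, smul_eq_mul]
        exact mul_nonpos_of_nonneg_of_nonpos (inv_pos.2 hjz).le (hz i hi)
      have hbx : 0 < b x₀ := by
        rw [hx₀, map_smul, smul_eq_mul]
        exact mul_pos (inv_pos.2 hjz) hbz
      obtain ⟨l, hl, hb⟩ := ih (fun i => a i - a i x₀ • a j) (b - b x₀ • a j) fun x hx => by
        have h1 := h (x - a j x • x₀) fun i hi => by
          rcases Finset.mem_insert.1 hi with rfl | hi
          · simp [hj1]
          · have := hx i hi
            simp only [LinearMap.sub_apply, LinearMap.smul_apply, smul_eq_mul] at this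
            simp only [map_sub, map_smul, smul_eq_mul]
            linarith [mul_comm (a i x₀) (a j x)]
        simp only [map_sub, map_smul, smul_eq_mul] at h1
        simp only [LinearMap.sub_apply, LinearMap.smul_apply, smul_eq_mul]
        linarith [mul_comm (b x₀) (a j x)]
      have hsum : ∑ i ∈ I, l i * a i x₀ ≤ 0 :=
        Finset.sum_nonpos fun i hi => mul_nonpos_of_nonneg_of_nonpos (hl i) (hax i hi)
      -- The coefficient of `a j` is forced by evaluation at `x₀`; it is nonnegative because `b x₀ >
      -- 0` and `a i x₀ ≤ 0` on `I`.
      refine ⟨Function.update l j (b x₀ - ∑ i ∈ I, l i * a i x₀), fun i => ?_, ?_⟩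
      · by_cases hij : i = j
        · subst hij
          rw [Function.update_self]
          linarith
        · simpa [hij] using hl i
      · rw [Finset.sum_insert hj, Function.update_self]
        have h2 : ∑ i ∈ I, Function.update l j (b x₀ - ∑ i ∈ I, l i * a i x₀) i • a i =
            ∑ i ∈ I, l i • a i :=
          Finset.sum_congr rfl fun i hi => by
            rw [Function.update_of_ne (ne_of_mem_of_not_mem hi hj)]
        rw [h2]
        refine LinearMap.ext fun x => ?_
        have h3 := LinearMap.congr_fun hb x
        simp only [LinearMap.sub_apply, LinearMap.smul_apply, smul_eq_mul, LinearMap.sum_apply,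
          LinearMap.add_apply, mul_sub, Finset.sum_sub_distrib, ← mul_assoc,
          ← Finset.sum_mul] at h3 ⊢
        linarith

section Balance

variable {ι V : Type*} [Fintype V]

/-- The linear form `H ↦ ∑ t, d t * H t`. -/
noncomputable def dotForm (d : V → ℝ) : (V → ℝ) →ₗ[ℝ] ℝ :=
  ∑ t, d t • LinearMap.proj t

theorem dotForm_apply (d H : V → ℝ) : dotForm d H = ∑ t, d t * H t := by
  simp [dotForm, LinearMap.sum_apply]

/-- A nonnegative weight that is balanced with respect to the vectors `d i`. -/
structure IsBalanced [Fintype ι] (d : ι → V → ℝ) (x : ι → ℝ) : Prop where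
  nonneg : ∀ i, 0 ≤ x i
  sum_eq_zero : ∀ t, ∑ i, x i * d i t = 0

theorem isBalanced_of_finset [Fintype ι] {I : Finset ι} {d : ι → V → ℝ} {l : ι → ℝ}
    (hl : ∀ i, 0 ≤ l i) (h : ∀ t, ∑ i ∈ I, l i * d i t = 0) :
    IsBalanced d (fun i => open Classical in if i ∈ I then l i else 0) := by
  classical
  refine ⟨fun i => ?_, fun t => ?_⟩
  · split_ifs
    exacts [hl i, le_rfl]
  · simpa [ite_mul, Finset.sum_ite_mem] using h t

/-- Homogenize with a scalar `ρ`: without a potential, `r i * ρ + d i · H ≤ 0` for all `i ∈ I`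
forces `ρ ≤ 0`. In the resulting Farkas identity the coefficients of `H` give balance and that of
`ρ` gives reward `1`. -/
theorem exists_potential_or_balanced_pos [Fintype ι] (I : Finset ι) (d : ι → V → ℝ) (r : ι → ℝ) :
    (∃ H : V → ℝ, ∀ i ∈ I, r i + ∑ t, d i t * H t ≤ 0) ∨
      ∃ x, IsBalanced d x ∧ (∀ i ∉ I, x i = 0) ∧ 0 < ∑ i, x i * r i := by
  classical
  refine or_iff_not_imp_left.2 fun hno => ?_
  obtain ⟨l, hl, hb⟩ := exists_nonneg_combination I
    (fun i => r i • LinearMap.snd ℝ (V → ℝ) ℝ + dotForm (d i) ∘ₗ LinearMap.fst ℝ (V → ℝ) ℝ)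
    (LinearMap.snd ℝ (V → ℝ) ℝ) (by
      rintro ⟨H, ρ⟩ hH
      by_contra hρ
      simp only [LinearMap.snd_apply, not_le] at hρ
      refine hno ⟨ρ⁻¹ • H, fun i hi => ?_⟩
      have h1 := hH i hi
      simp only [LinearMap.add_apply, LinearMap.smul_apply, LinearMap.snd_apply, smul_eq_mul,
        LinearMap.comp_apply, LinearMap.fst_apply] at h1
      rw [← dotForm_apply, map_smul, smul_eq_mul]
      have h2 : r i + ρ⁻¹ * dotForm (d i) H = ρ⁻¹ * (r i * ρ + dotForm (d i) H) := by
        field_simp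
      rw [h2]
      exact mul_nonpos_of_nonneg_of_nonpos (inv_pos.2 hρ).le h1)
  refine ⟨_, isBalanced_of_finset hl fun t => ?_, fun i hi => if_neg hi, ?_⟩
  · have h1 := LinearMap.congr_fun hb (Pi.single t 1, 0)
    simp only [LinearMap.sum_apply, LinearMap.add_apply, LinearMap.smul_apply,
      LinearMap.snd_apply, smul_eq_mul, LinearMap.comp_apply, LinearMap.fst_apply,
      dotForm_apply] at h1
    simpa [Pi.single_apply] using h1.symm
  · have h1 := LinearMap.congr_fun hb (0, 1)
    simp only [LinearMap.sum_apply, LinearMap.add_apply, LinearMap.smul_apply,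
      LinearMap.snd_apply, smul_eq_mul, LinearMap.comp_apply, LinearMap.fst_apply,
      map_zero, mul_one, add_zero] at h1
    simp only [ite_mul, zero_mul, Finset.sum_ite_mem, Finset.univ_inter, ← h1]
    exact one_pos

/-- Homogenize with `ρ ≥ 0` (the index `none`) and the slack `δ`. In the Farkas identity the
coefficient of `δ` gives total weight `1`, and that of `ρ` gives reward `-l none ≤ 0`. -/
theorem exists_potential_or_balanced_nonpos [Fintype ι] (I : Finset ι) (d : ι → V → ℝ)
    (r : ι → ℝ) :
    (∃ H : V → ℝ, ∃ δ > 0, ∀ i ∈ I, δ ≤ r i + ∑ t, d i t * H t) ∨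
      ∃ x, IsBalanced d x ∧ (∀ i ∉ I, x i = 0) ∧ (∃ i, x i ≠ 0) ∧ ∑ i, x i * r i ≤ 0 := by
  classical
  refine or_iff_not_imp_left.2 fun hno => ?_
  let prH : (V → ℝ) × ℝ × ℝ →ₗ[ℝ] (V → ℝ) := LinearMap.fst ℝ _ _
  let prR : (V → ℝ) × ℝ × ℝ →ₗ[ℝ] ℝ := LinearMap.fst ℝ ℝ ℝ ∘ₗ LinearMap.snd ℝ _ _
  let prD : (V → ℝ) × ℝ × ℝ →ₗ[ℝ] ℝ := LinearMap.snd ℝ ℝ ℝ ∘ₗ LinearMap.snd ℝ _ _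
  obtain ⟨l, hl, hb⟩ := exists_nonneg_combination (insert none (I.map .some))
    (fun j => j.elim (-prR) fun i => prD - r i • prR - dotForm (d i) ∘ₗ prH)
    prD (by
      rintro ⟨H, ρ, δ⟩ hH
      by_contra hδ
      have hδ' : 0 < δ := not_le.1 hδ
      have hρ : 0 ≤ ρ := by simpa [prR] using hH none (Finset.mem_insert_self _ _)
      have hi : ∀ i ∈ I, δ ≤ r i * ρ + dotForm (d i) H := fun i hi => by
        have := hH (some i) (by simpa using hi)
        simp only [Option.elim, prD, prR, prH, LinearMap.sub_apply, LinearMap.smul_apply,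
          LinearMap.comp_apply, LinearMap.fst_apply, LinearMap.snd_apply, smul_eq_mul] at this
        linarith
      rcases hρ.eq_or_lt with rfl | hρ
      -- If `ρ = 0`, then `H` alone has drift at least `δ`; a large multiple of it outweighs all
      -- rewards and leaves slack `1`.
      · set M := ∑ i, |r i| with hM
        have hM0 : 0 ≤ M := Finset.sum_nonneg fun i _ => abs_nonneg _
        refine hno ⟨((1 + M) / δ) • H, 1, one_pos, fun i hiI => ?_⟩
        rw [← dotForm_apply, map_smul, smul_eq_mul]
        have h1 := hi i hiI
        rw [mul_zero, zero_add] at h1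
        have h2 : (1 + M) / δ * δ ≤ (1 + M) / δ * dotForm (d i) H :=
          mul_le_mul_of_nonneg_left h1 (by positivity)
        rw [div_mul_cancel₀ _ hδ'.ne'] at h2
        have h3 : |r i| ≤ M :=
          Finset.single_le_sum (f := fun i => |r i|) (fun i _ => abs_nonneg _) (Finset.mem_univ i)
        have h4 := neg_abs_le (r i)
        linarith
      · refine hno ⟨ρ⁻¹ • H, ρ⁻¹ * δ, mul_pos (inv_pos.2 hρ) hδ', fun i hiI => ?_⟩
        rw [← dotForm_apply, map_smul, smul_eq_mul]
        have h2 : r i + ρ⁻¹ * dotForm (d i) H = ρ⁻¹ * (r i * ρ + dotForm (d i) H) := by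
          field_simp
        rw [h2]
        exact mul_le_mul_of_nonneg_left (hi i hiI) (inv_pos.2 hρ).le)
  have hb' : ∀ z, prD z = l none * -prR z +
      ∑ i ∈ I, l (some i) * (prD z - r i * prR z - dotForm (d i) (prH z)) := fun z => by
    have := LinearMap.congr_fun hb z
    rw [Finset.sum_insert (by simp), Finset.sum_map] at this
    simpa [LinearMap.sum_apply] using this
  have hsum : ∑ i ∈ I, l (some i) = 1 := by
    have := hb' (0, 0, 1)
    simpa [prD, prR, prH] using this.symm
  have hrew : ∑ i ∈ I, l (some i) * r i = -l none := by
    have := hb' (0, 1, 0)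
    simp [prD, prR, prH] at this
    linarith
  refine ⟨_, isBalanced_of_finset (I := I) (l := fun i => l (some i)) (fun i => hl _)
    fun t => ?_, fun i hi => if_neg hi, ?_, ?_⟩
  · have := hb' (Pi.single t 1, 0, 0)
    simpa [prD, prR, prH, dotForm_apply, Pi.single_apply] using this
  · by_contra! hc
    have h1 : ∑ i ∈ I, l (some i) = 0 :=
      Finset.sum_eq_zero fun i hi => by simpa [hi] using hc i
    linarith
  · simp only [ite_mul, zero_mul, Finset.sum_ite_mem, Finset.univ_inter, hrew]
    linarith [hl none]

/-- Support reduction: a balanced weight with a reward satisfying `Q` can be chosen such that the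
rewards of all balanced weights on its support satisfy `Q`. -/
theorem exists_balanced_minimal [Fintype ι] {d : ι → V → ℝ} {r : ι → ℝ} {Q : ℝ → Prop}
    (hQ : ∀ a b, Q a → ¬ Q b → ∀ t > 0, Q (a - t * b) ∧ a - t * b ≠ 0) {x : ι → ℝ}
    (hx : IsBalanced d x) (hx0 : ∃ i, x i ≠ 0) (hxQ : Q (∑ i, x i * r i)) :
    ∃ y, IsBalanced d y ∧ (∀ i, x i = 0 → y i = 0) ∧ (∃ i, y i ≠ 0) ∧
      ∀ z, IsBalanced d z → (∃ i, z i ≠ 0) → (∀ i, y i = 0 → z i = 0) → Q (∑ i, z i * r i) := by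
  classical
  induction hn : (Finset.univ.filter fun i => x i ≠ 0).card using Nat.strong_induction_on
    generalizing x with
  | _ n ih =>
  by_cases hmin : ∀ z, IsBalanced d z → (∃ i, z i ≠ 0) → (∀ i, x i = 0 → z i = 0) →
      Q (∑ i, z i * r i)
  · exact ⟨x, hx, fun i hi => hi, hx0, hmin⟩
  push Not at hmin
  obtain ⟨z, hz, ⟨i₀, hi₀⟩, hzx, hzQ⟩ := hmin
  -- The minimal ratio is the largest multiple of `z` that can be removed from `x` without losing
  -- nonnegativity; it annihilates the coordinate `j`.
  obtain ⟨j, hj, hjmin⟩ := (Finset.univ.filter fun i => z i ≠ 0).exists_min_image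
    (fun i => x i / z i) ⟨i₀, by simpa using hi₀⟩
  have hzpos : ∀ i, z i ≠ 0 → 0 < z i := fun i hi => (hz.nonneg i).lt_of_ne' hi
  have hjz : z j ≠ 0 := by simpa using hj
  have hjx : x j ≠ 0 := fun h => hjz (hzx j h)
  set t := x j / z j with ht
  have ht0 : 0 < t := div_pos ((hx.nonneg j).lt_of_ne' hjx) (hzpos j hjz)
  have hrew : ∑ i, (x i - t * z i) * r i = ∑ i, x i * r i - t * ∑ i, z i * r i := by
    rw [Finset.mul_sum, ← Finset.sum_sub_distrib]
    exact Finset.sum_congr rfl fun i _ => by ring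
  have hQ' := hQ _ _ hxQ hzQ t ht0
  rw [← hrew] at hQ'
  have hbal : IsBalanced d fun i => x i - t * z i := by
    refine ⟨fun i => ?_, fun u => ?_⟩
    · by_cases hi : z i = 0
      · simpa [hi] using hx.nonneg i
      · have := hjmin i (by simpa using hi)
        rw [le_div_iff₀ (hzpos i hi)] at this
        linarith
    · have : ∑ i, (x i - t * z i) * d i u = ∑ i, x i * d i u - t * ∑ i, z i * d i u := by
        rw [Finset.mul_sum, ← Finset.sum_sub_distrib]
        exact Finset.sum_congr rfl fun i _ => by ring
      rw [this, hx.sum_eq_zero, hz.sum_eq_zero, mul_zero, sub_zero]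
  have hsub : ∀ i, x i = 0 → x i - t * z i = 0 := fun i hi => by
    rw [hi, hzx i hi, mul_zero, sub_zero]
  have hcard : (Finset.univ.filter fun i => x i - t * z i ≠ 0).card < n := by
    rw [← hn]
    refine Finset.card_lt_card ⟨fun i hi => ?_, fun hss => ?_⟩
    · simp only [Finset.mem_filter, Finset.mem_univ, true_and] at hi ⊢
      exact fun h => hi (hsub i h)
    · have := hss (Finset.mem_filter.2 ⟨Finset.mem_univ j, hjx⟩)
      simp only [Finset.mem_filter, Finset.mem_univ, true_and] at this
      exact this (by rw [ht, div_mul_cancel₀ _ hjz, sub_self])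
  -- A nonzero reward, provided by `hQ`, prevents the remainder from vanishing.
  have hne : ∃ i, x i - t * z i ≠ 0 := by
    by_contra! hc
    exact hQ'.2 (Finset.sum_eq_zero fun i _ => by rw [hc i, zero_mul])
  obtain ⟨y, hy1, hy2, hy3⟩ := ih _ hcard hbal hne hQ'.1 rfl
  exact ⟨y, hy1, fun i hi => hy2 i (hsub i hi), hy3⟩

end Balance

/-! ### From circulations to memoryless strategies -/

namespace MDP

/-- The memoryless strategy that plays `q`. -/
noncomputable def Strategy.ofPolicy {V : Type*} {G : MDP V} (q : V → PMF V)
    (hq : ∀ s u, q s u ≠ 0 → G.edge s u) : G.Strategy where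
  act _ h _ := q h.last
  edge_of_mem_support _ h _ u hu := hq h.last u hu

variable {V : Type*} [Fintype V] (G : MDP V) (σ : G.Strategy)

/-- The expectation of `f` at the next state when the edge to `u` is chosen in `s`. -/
noncomputable def moveExp (s u : V) (f : V → ℝ) : ℝ :=
  ∑ t, (G.move s u t).toReal * f t

theorem nextExp_of_mem {n : ℕ} {h : History V n} (hc : h.last ∈ G.controlled) (f : V → ℝ) :
    G.nextExp σ h f = ∑ u, (σ.act n h hc u).toReal * G.moveExp h.last u f := by
  classical
  refine Finset.sum_congr rfl fun u _ => ?_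
  rw [next, dif_pos hc, moveExp, move, dif_pos hc]
  simp [PMF.pure_apply, apply_ite ENNReal.toReal]

theorem nextExp_of_notMem {n : ℕ} {h : History V n} (hc : h.last ∉ G.controlled) (u : V)
    (f : V → ℝ) : G.nextExp σ h f = G.moveExp h.last u f := by
  rw [nextExp, next, dif_neg hc, moveExp, move, dif_neg hc]

/-- In a controlled state the expectation is an average over outgoing edges; in a random state every
edge gives the same value, so any one will do. -/
theorem nextExp_le_of_moveExp_le {n : ℕ} {h : History V n} {f : V → ℝ} {b : ℝ}
    (hb : ∀ u, G.edge h.last u → G.moveExp h.last u f ≤ b) : G.nextExp σ h f ≤ b := by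
  by_cases hc : h.last ∈ G.controlled
  · rw [nextExp_of_mem G σ hc, ← one_mul b, ← sum_toReal_eq_one (σ.act n h hc), Finset.sum_mul]
    refine Finset.sum_le_sum fun u _ => ?_
    by_cases hu : σ.act n h hc u = 0
    · simp [hu]
    · exact mul_le_mul_of_nonneg_left (hb u (σ.edge_of_mem_support n h hc u hu))
        ENNReal.toReal_nonneg
  · obtain ⟨u, hu⟩ := G.exists_edge h.last
    rw [G.nextExp_of_notMem σ hc u]
    exact hb u hu

theorem moveExp_neg (s u : V) (f : V → ℝ) : G.moveExp s u (fun t => -1 * f t) = -G.moveExp s u f := by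
  simp [moveExp]

theorem le_nextExp_of_le_moveExp {n : ℕ} {h : History V n} {f : V → ℝ} {b : ℝ}
    (hb : ∀ u, G.edge h.last u → b ≤ G.moveExp h.last u f) : b ≤ G.nextExp σ h f := by
  have := G.nextExp_le_of_moveExp_le σ (h := h) (f := fun t => -1 * f t) (b := -b) fun u hu => by
    rw [moveExp_neg]
    exact neg_le_neg (hb u hu)
  rw [nextExp_const_mul] at this
  linarith

theorem nextExp_ofPolicy (q : V → PMF V) (hq : ∀ s u, q s u ≠ 0 → G.edge s u) {n : ℕ}
    (h : History V n) (f : V → ℝ) : G.nextExp (Strategy.ofPolicy q hq) h f =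
      ∑ u, (q h.last u).toReal * G.moveExp h.last u f := by
  by_cases hc : h.last ∈ G.controlled
  · exact G.nextExp_of_mem _ hc f
  · have h1 : ∀ u, G.moveExp h.last u f = G.nextExp (Strategy.ofPolicy q hq) h f := fun u =>
      (G.nextExp_of_notMem _ hc u f).symm
    simp only [h1]
    rw [← Finset.sum_mul, sum_toReal_eq_one, one_mul]

open Classical in
/-- The expected change of the indicator of `t` when the edge `e.2` is chosen in `e.1`. -/
noncomputable def drift (e : V × V) (t : V) : ℝ :=
  (G.move e.1 e.2 t).toReal - if t = e.1 then 1 else 0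

theorem sum_drift_mul (e : V × V) (f : V → ℝ) :
    ∑ t, G.drift e t * f t = G.moveExp e.1 e.2 f - f e.1 := by
  classical
  simp [drift, moveExp, sub_mul, Finset.sum_sub_distrib]

/-- The drift of a policy. -/
noncomputable def policyDrift (q : V → PMF V) (s t : V) : ℝ :=
  ∑ u, (q s u).toReal * G.drift (s, u) t

theorem sum_policyDrift_mul (q : V → PMF V) (s : V) (f : V → ℝ) :
    ∑ t, G.policyDrift q s t * f t = ∑ u, (q s u).toReal * G.moveExp s u f - f s := by
  have h1 : ∀ u, (q s u).toReal * G.moveExp s u f =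
      (q s u).toReal * ∑ t, G.drift (s, u) t * f t + (q s u).toReal * f s := fun u => by
    rw [sum_drift_mul]; ring
  simp only [h1, Finset.sum_add_distrib]
  rw [← Finset.sum_mul, sum_toReal_eq_one, one_mul, add_sub_cancel_right]
  simp only [policyDrift, Finset.sum_mul, Finset.mul_sum]
  rw [Finset.sum_comm]
  exact Finset.sum_congr rfl fun u _ => Finset.sum_congr rfl fun t _ => by ring

/-- A flow on the edges is turned into a policy: the set `S` of the states with a positive flow is
closed under the policy, and stationary weights of the policy are flows. -/
theorem exists_policy_of_balanced {r : V → ℝ} {Q : ℝ → Prop} {y : V × V → ℝ}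
    (hy : IsBalanced G.drift y) (hy0 : ∃ e, y e ≠ 0) (hedge : ∀ e, y e ≠ 0 → G.edge e.1 e.2)
    (hmin : ∀ z, IsBalanced G.drift z → (∃ e, z e ≠ 0) → (∀ e, y e = 0 → z e = 0) →
      Q (∑ e, z e * r e.1)) :
    ∃ (S : Finset V) (q : V → PMF V), (∃ s, s ∈ S) ∧ (∀ s ∈ S, ∃ u, y (s, u) ≠ 0) ∧
      (∀ s u, q s u ≠ 0 → G.edge s u) ∧
      (∀ s ∈ S, ∀ u t, q s u ≠ 0 → G.move s u t ≠ 0 → t ∈ S) ∧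
      ∀ z, IsBalanced (G.policyDrift q) z → (∃ s, z s ≠ 0) → (∀ s ∉ S, z s = 0) →
        Q (∑ s, z s * r s) := by
  classical
  -- The policy chooses edges in proportion to their flow; states without flow get an arbitrary
  -- edge.
  set π : V → ℝ := fun s => ∑ u, y (s, u) with hπ
  have hπ0 : ∀ s, 0 ≤ π s := fun s => Finset.sum_nonneg fun u _ => hy.nonneg _
  have hle : ∀ s u, y (s, u) ≤ π s := fun s u =>
    Finset.single_le_sum (f := fun u => y (s, u)) (fun u _ => hy.nonneg _) (Finset.mem_univ u)
  choose a ha using G.exists_edge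
  have hsum1 : ∀ s, π s ≠ 0 → ∑ u, ENNReal.ofReal (y (s, u) / π s) = 1 := fun s hs => by
    rw [← ENNReal.ofReal_sum_of_nonneg fun u _ => div_nonneg (hy.nonneg _) (hπ0 s),
      ← Finset.sum_div, div_self hs, ENNReal.ofReal_one]
  let q : V → PMF V := fun s =>
    if hs : π s ≠ 0 then PMF.ofFintype (fun u => ENNReal.ofReal (y (s, u) / π s)) (hsum1 s hs)
    else PMF.pure (a s)
  have hq : ∀ s, π s ≠ 0 → ∀ u, q s u = ENNReal.ofReal (y (s, u) / π s) := fun s hs u => by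
    simp only [q, dif_pos hs, PMF.ofFintype_apply]
  have hq' : ∀ s, π s ≠ 0 → ∀ u, (q s u).toReal = y (s, u) / π s := fun s hs u => by
    rw [hq s hs, ENNReal.toReal_ofReal (div_nonneg (hy.nonneg _) (hπ0 s))]
  have hqy : ∀ s, π s ≠ 0 → ∀ u, q s u ≠ 0 → y (s, u) ≠ 0 := fun s hs u hu h => by
    rw [hq s hs, h, zero_div, ENNReal.ofReal_zero] at hu
    exact hu rfl
  -- Inflow equals outflow, so a state that receives flow also emits some; hence `S` is closed.
  have hbal : ∀ t, ∑ e, y e * (G.move e.1 e.2 t).toReal = π t := fun t => by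
    have h := hy.sum_eq_zero t
    simp only [drift, mul_sub, Finset.sum_sub_distrib] at h
    rw [sub_eq_zero.1 h, Fintype.sum_prod_type]
    simp [hπ]
  refine ⟨Finset.univ.filter fun s => π s ≠ 0, q, ?_, fun s hs => ?_, fun s u hu => ?_,
    fun s hs u t hu ht => ?_, fun z hz ⟨s₀, hs₀⟩ hzS => ?_⟩
  · obtain ⟨⟨s, u⟩, h⟩ := hy0
    refine ⟨s, Finset.mem_filter.2 ⟨Finset.mem_univ s, ?_⟩⟩
    exact (((hy.nonneg _).lt_of_ne' h).trans_le (hle s u)).ne'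
  · by_contra! hc
    exact (Finset.mem_filter.1 hs).2 (Finset.sum_eq_zero fun u _ => hc u)
  · by_cases hs : π s = 0
    · have h1 : q s = PMF.pure (a s) := dif_neg (not_not.2 hs)
      rw [h1, PMF.pure_apply] at hu
      have : u = a s := by
        by_contra h
        exact hu (if_neg h)
      exact this ▸ ha s
    · exact hedge _ (hqy s hs u hu)
  · refine Finset.mem_filter.2 ⟨Finset.mem_univ t, ?_⟩
    have h1 : 0 < y (s, u) := (hy.nonneg _).lt_of_ne' (hqy s (Finset.mem_filter.1 hs).2 u hu)
    have h2 : 0 < (G.move s u t).toReal := ENNReal.toReal_pos ht (PMF.apply_ne_top _ _)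
    rw [← hbal t]
    refine ((mul_pos h1 h2).trans_le ?_).ne'
    exact Finset.single_le_sum (f := fun e : V × V => y e * (G.move e.1 e.2 t).toReal)
      (fun e _ => mul_nonneg (hy.nonneg _) ENNReal.toReal_nonneg) (Finset.mem_univ (s, u))
  · have hzS' : ∀ s, π s = 0 → z s = 0 := fun s hs => hzS s (by simp [hs])
    -- A stationary weight of the policy lifts to a circulation on the support of `y`.
    have h := hmin (fun e => z e.1 * (q e.1 e.2).toReal) ⟨fun e => ?_, fun t => ?_⟩ ?_
      fun e he => ?_
    · rw [Fintype.sum_prod_type] at h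
      have h1 : ∀ s, ∑ u, z s * (q s u).toReal * r s = z s * r s := fun s => by
        rw [← Finset.sum_mul, ← Finset.mul_sum, sum_toReal_eq_one, mul_one]
      simpa only [h1] using h
    · exact mul_nonneg (hz.nonneg _) ENNReal.toReal_nonneg
    · rw [Fintype.sum_prod_type, ← hz.sum_eq_zero t]
      simp only [policyDrift, Finset.mul_sum, mul_assoc]
    · by_contra! hc
      have h1 : z s₀ * ∑ u, (q s₀ u).toReal = 0 := by
        rw [Finset.mul_sum]
        exact Finset.sum_eq_zero fun u _ => hc (s₀, u)
      rw [sum_toReal_eq_one, mul_one] at h1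
      exact hs₀ h1
    · obtain ⟨s, u⟩ := e
      by_cases hs : π s = 0
      · simp [hzS' s hs]
      · simp [hq' s hs, he]

variable [MeasurableSpace V] [DiscreteMeasurableSpace V]

open Classical in
/-- The function that vanishes on the closed set `S` and is `1` outside is superharmonic. -/
theorem nextExp_compl_le {S : Finset V} {q : V → PMF V} (hq : ∀ s u, q s u ≠ 0 → G.edge s u)
    (hS : ∀ s ∈ S, ∀ u t, q s u ≠ 0 → G.move s u t ≠ 0 → t ∈ S) {n : ℕ} (h : History V n) :
    G.nextExp (Strategy.ofPolicy q hq) h (fun s => if s ∈ S then 0 else 1) ≤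
      if h.last ∈ S then 0 else 1 := by
  split_ifs with hh
  · rw [nextExp_ofPolicy]
    refine (Finset.sum_eq_zero fun u _ => ?_).le
    by_cases hu : q h.last u = 0
    · simp [hu]
    · have : G.moveExp h.last u (fun s => if s ∈ S then 0 else 1) = 0 := by
        refine Finset.sum_eq_zero fun t _ => ?_
        by_cases ht : G.move h.last u t = 0
        · simp [ht]
        · simp [hS _ hh u t hu ht]
      rw [this, mul_zero]
  · exact (G.nextExp_mono _ h fun u => by split_ifs <;> simp).trans (G.nextExp_const _ h 1).le

/-- After support reduction every nonzero stationary weight of the policy on `S` has positive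
reward. Duality then leaves only a potential with uniformly positive drift on `S`. -/
theorem exists_strategy_meanPos {r : V → ℤ} {P : V × V → Prop}
    (hP : ∀ e, P e → G.edge e.1 e.2) {x : V × V → ℝ} (hx : IsBalanced G.drift x)
    (hxP : ∀ e, ¬ P e → x e = 0) (hxr : 0 < ∑ e, x e * r e.1) :
    ∃ (s u : V) (σ : G.Strategy), P (s, u) ∧ G.pr σ s (G.meanPos r)ᶜ = 0 := by
  classical
  obtain ⟨y, hy, hyx, hy0, hmin⟩ := exists_balanced_minimal (d := G.drift)
    (r := fun e => (r e.1 : ℝ)) (Q := (0 < ·))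
    (fun a b ha hb t ht => by
      have : t * b ≤ 0 := mul_nonpos_of_nonneg_of_nonpos ht.le (not_lt.1 hb)
      have h0 : 0 < a - t * b := by linarith
      exact ⟨h0, h0.ne'⟩) hx
    (by
      by_contra! hc
      exact hxr.ne' (Finset.sum_eq_zero fun e _ => by rw [hc e, zero_mul])) hxr
  have hyP : ∀ e, y e ≠ 0 → P e := fun e he => by
    by_contra hc
    exact he (hyx e (hxP e hc))
  obtain ⟨S, q, ⟨s, hs⟩, hSy, hq, hS, hst⟩ := G.exists_policy_of_balanced hy hy0
    (fun e he => hP e (hyP e he)) (r := fun s => (r s : ℝ)) (Q := (0 < ·)) hmin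
  obtain ⟨u, hu⟩ := hSy s hs
  refine ⟨s, u, Strategy.ofPolicy q hq, hyP _ hu, ?_⟩
  rcases exists_potential_or_balanced_nonpos S (G.policyDrift q) (fun s => (r s : ℝ)) with
    ⟨H, δ, hδ, hH⟩ | ⟨z, hz, hzS, hz0, hzr⟩
  -- The function is `0` on `S` and `1` elsewhere, so `S` is the only level below `1` and the bound
  -- vanishes at `s`.
  · have h := G.pr_compl_meanPos_le (Strategy.ofPolicy q hq) s (r := r)
      (v := fun s => if s ∈ S then 0 else 1) (fun u => by split_ifs <;> simp)
      (fun u => by split_ifs <;> simp) (fun n h => G.nextExp_compl_le hq hS h)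
      fun c hc => ⟨H, δ, hδ, fun n h hh => by
        have hmem : h.last ∈ S := by
          by_contra hns
          rw [if_neg hns] at hh
          exact hc.ne hh.symm
        have := hH _ hmem
        rw [sum_policyDrift_mul, ← nextExp_ofPolicy G q hq h H] at this
        linarith⟩
    simpa [hs] using h
  · exact absurd (hst z hz hz0 hzS) (not_lt.2 hzr)

/-- Here support reduction preserves nonpositive reward, and duality yields a potential with
nonpositive drift on `S`. -/
theorem exists_strategy_limInfEqTop {r : V → ℤ} {P : V × V → Prop}
    (hP : ∀ e, P e → G.edge e.1 e.2) {x : V × V → ℝ} (hx : IsBalanced G.drift x)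
    (hxP : ∀ e, ¬ P e → x e = 0) (hx0 : ∃ e, x e ≠ 0) (hxr : ∑ e, x e * r e.1 ≤ 0) :
    ∃ (s u : V) (σ : G.Strategy), P (s, u) ∧ G.pr σ s (G.limInfEqTop r) = 0 := by
  classical
  obtain ⟨y, hy, hyx, hy0, hmin⟩ := exists_balanced_minimal (d := G.drift)
    (r := fun e => (r e.1 : ℝ)) (Q := (· ≤ 0))
    (fun a b ha hb t ht => by
      have : 0 < t * b := mul_pos ht (not_le.1 hb)
      have h0 : a - t * b < 0 := by linarith
      exact ⟨h0.le, h0.ne⟩) hx hx0 hxr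
  have hyP : ∀ e, y e ≠ 0 → P e := fun e he => by
    by_contra hc
    exact he (hyx e (hxP e hc))
  obtain ⟨S, q, ⟨s, hs⟩, hSy, hq, hS, hst⟩ := G.exists_policy_of_balanced hy hy0
    (fun e he => hP e (hyP e he)) (r := fun s => (r s : ℝ)) (Q := (· ≤ 0)) hmin
  obtain ⟨u, hu⟩ := hSy s hs
  refine ⟨s, u, Strategy.ofPolicy q hq, hyP _ hu, ?_⟩
  rcases exists_potential_or_balanced_pos S (G.policyDrift q) (fun s => (r s : ℝ)) with
    ⟨H, hH⟩ | ⟨z, hz, hzS, hzr⟩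
  · have h := G.pr_limInfEqTop_le (Strategy.ofPolicy q hq) s (r := r)
      (v := fun s => if s ∈ S then 0 else 1) (fun u => by split_ifs <;> simp)
      (fun u => by split_ifs <;> simp) (fun n h => G.nextExp_compl_le hq hS h)
      fun c hc => ⟨H, fun n h hh => by
        have hmem : h.last ∈ S := by
          by_contra hns
          rw [if_neg hns] at hh
          exact hc.ne hh.symm
        have := hH _ hmem
        rw [sum_policyDrift_mul, ← nextExp_ofPolicy G q hq h H] at this
        linarith⟩
    simpa [hs] using h
  · refine absurd (hst z hz ?_ hzS) (not_le.2 hzr)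
    by_contra! hc
    exact hzr.ne' (Finset.sum_eq_zero fun e _ => by rw [hc e, zero_mul])

end MDP

/-! ### Superharmonicity of the value and comparison of the objectives -/

namespace MDP

variable {V : Type*} [Fintype V] [MeasurableSpace V] [DiscreteMeasurableSpace V] (G : MDP V)
  (σ : G.Strategy) (s : V)

/-- The supremum of the probabilities of `O` over all strategies. -/
noncomputable def supVal (O : Set (ℕ → V)) (s : V) : ENNReal :=
  ⨆ σ : G.Strategy, G.pr σ s O

theorem pr_le_supVal (O : Set (ℕ → V)) : G.pr σ s O ≤ G.supVal O s :=
  le_iSup (fun σ : G.Strategy => G.pr σ s O) σ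

theorem supVal_le_one (O : Set (ℕ → V)) : G.supVal O s ≤ 1 :=
  iSup_le fun _ => prob_le_one

theorem supVal_ne_top (O : Set (ℕ → V)) : G.supVal O s ≠ ⊤ :=
  ne_top_of_le_ne_top ENNReal.one_ne_top (G.supVal_le_one s O)

theorem exists_supVal_le_add (O : Set (ℕ → V)) {ε : ENNReal} (hε : ε ≠ 0) :
    ∃ σ : G.Strategy, G.supVal O s ≤ G.pr σ s O + ε := by
  -- At value `0` any strategy will do, but one has to be exhibited.
  by_cases h0 : G.supVal O s = 0
  · choose a ha using G.exists_edge
    refine ⟨Strategy.ofPolicy (fun s => PMF.pure (a s)) fun s u hu => ?_, by simp [h0]⟩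
    have : u = a s := by
      by_contra h
      exact hu (by simp [PMF.pure_apply, h])
    exact this ▸ ha s
  · obtain ⟨σ, hσ⟩ := lt_iSup_iff.1 (ENNReal.sub_lt_self (G.supVal_ne_top s O) h0 hε)
    exact ⟨σ, tsub_le_iff_right.1 hσ.le⟩

/-- Move along `u`, then play an `ε`-optimal strategy for the state reached. -/
theorem sum_move_mul_supVal_le {O : Set (ℕ → V)} (hO : MeasurableSet O)
    (hO' : ∀ w : ℕ → V, G.edge (w 0) (w 1) → (w ∈ O ↔ (fun i => w (i + 1)) ∈ O)) {u : V}
    (hu : G.edge s u) : ∑ t, G.move s u t * G.supVal O t ≤ G.supVal O s := by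
  classical
  refine ENNReal.le_of_forall_pos_le_add fun ε hε _ => ?_
  choose τ hτ using fun t =>
    G.exists_supVal_le_add t O (ε := (ε : ENNReal)) (by exact_mod_cast hε.ne')
  choose a ha using G.exists_edge
  have hb : ∀ t, G.edge t (Function.update a s u t) := fun t => by
    by_cases h : t = s
    · subst h
      simpa using hu
    · simpa [h] using ha t
  have hsum : ∑ t, G.move s u t = 1 := by
    rw [← tsum_fintype (L := .unconditional _), PMF.tsum_coe]
  have h := G.pr_delay s _ hb τ hO hO'
  rw [Function.update_self] at h
  calc ∑ t, G.move s u t * G.supVal O t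
      ≤ ∑ t, (G.move s u t * G.pr (τ t) t O + G.move s u t * ε) :=
        Finset.sum_le_sum fun t _ => by
          rw [← mul_add]
          exact mul_le_mul_right (hτ t) _
    _ = G.pr (Strategy.delay _ hb τ) s O + ε := by
        rw [Finset.sum_add_distrib, ← h, ← Finset.sum_mul, hsum, one_mul]
    _ ≤ G.supVal O s + ε := add_le_add_left (G.pr_le_supVal _ _ _) _

theorem nextExp_supVal_le {O : Set (ℕ → V)} (hO : MeasurableSet O)
    (hO' : ∀ w : ℕ → V, G.edge (w 0) (w 1) → (w ∈ O ↔ (fun i => w (i + 1)) ∈ O)) {n : ℕ}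
    (h : History V n) :
    G.nextExp σ h (fun u => (G.supVal O u).toReal) ≤ (G.supVal O h.last).toReal := by
  refine G.nextExp_le_of_moveExp_le σ fun u hu => ?_
  have h1 := ENNReal.toReal_mono (G.supVal_ne_top _ O)
    (G.sum_move_mul_supVal_le h.last hO hO' hu)
  rw [ENNReal.toReal_sum fun t _ =>
    ENNReal.mul_ne_top (PMF.apply_ne_top _ _) (G.supVal_ne_top t O)] at h1
  simp only [ENNReal.toReal_mul] at h1
  exact h1

theorem supVal_eq_one_of_pr_compl_eq_zero {O : Set (ℕ → V)} (hO : MeasurableSet O)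
    (h : G.pr σ s Oᶜ = 0) : (G.supVal O s).toReal = 1 := by
  have h1 : G.pr σ s O = 1 := (prob_compl_eq_zero_iff hO).1 h
  have h2 : G.supVal O s = 1 := le_antisymm (G.supVal_le_one s O) (h1 ▸ G.pr_le_supVal σ s O)
  rw [h2, ENNReal.toReal_one]

theorem supVal_toReal_le_one (O : Set (ℕ → V)) : (G.supVal O s).toReal ≤ 1 :=
  ENNReal.toReal_mono ENNReal.one_ne_top (G.supVal_le_one s O)

/-- No strategy makes the accumulated reward tend to infinity with a probability above the
maximal value of a positive mean payoff. -/
theorem pr_limInfEqTop_le_supVal (r : V → ℤ) :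
    G.pr σ s (G.limInfEqTop r) ≤ G.supVal (G.meanPos r) s := by
  classical
  rw [← ENNReal.ofReal_toReal (G.supVal_ne_top s (G.meanPos r))]
  refine G.pr_limInfEqTop_le σ s (v := fun u => (G.supVal (G.meanPos r) u).toReal)
    (fun u => ENNReal.toReal_nonneg) (fun u => G.supVal_toReal_le_one u _)
    (fun n h => G.nextExp_supVal_le σ (G.measurableSet_meanPos r)
      (fun w hw => G.tail_mem_meanPos_iff r hw) h) fun c hc => ?_
  -- Duality is applied to the edges that start in level `c`; their targets may leave it.
  let P : V × V → Prop := fun e => G.edge e.1 e.2 ∧ (G.supVal (G.meanPos r) e.1).toReal = c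
  rcases exists_potential_or_balanced_pos (Finset.univ.filter P) G.drift
    (fun e => (r e.1 : ℝ)) with ⟨H, hH⟩ | ⟨x, hx, hxP, hxr⟩
  · refine ⟨H, fun n h hh => ?_⟩
    have := G.nextExp_le_of_moveExp_le σ (h := h) (f := H) (b := H h.last - r h.last) fun u hu => by
      have := hH (h.last, u) (Finset.mem_filter.2 ⟨Finset.mem_univ _, hu, hh⟩)
      rw [sum_drift_mul] at this
      linarith
    linarith
  -- A profitable circulation would give a state of level `c` the value `1`.
  · obtain ⟨t, u, τ, hP, hτ⟩ := G.exists_strategy_meanPos (P := P) (fun e he => he.1) hx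
      (fun e he => hxP e (by simpa using he)) hxr
    have h1 := G.supVal_eq_one_of_pr_compl_eq_zero τ t (G.measurableSet_meanPos r) hτ
    exact absurd (h1.symm.trans hP.2) hc.ne'

/-- No strategy avoids a positive mean payoff with a probability above the maximal value of an
accumulated reward that does not tend to infinity. -/
theorem pr_compl_meanPos_le_supVal (r : V → ℤ) :
    G.pr σ s (G.meanPos r)ᶜ ≤ G.supVal (G.limInfEqTop r)ᶜ s := by
  classical
  rw [← ENNReal.ofReal_toReal (G.supVal_ne_top s (G.limInfEqTop r)ᶜ)]
  refine G.pr_compl_meanPos_le σ s (v := fun u => (G.supVal (G.limInfEqTop r)ᶜ u).toReal)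
    (fun u => ENNReal.toReal_nonneg) (fun u => G.supVal_toReal_le_one u _)
    (fun n h => G.nextExp_supVal_le σ (G.measurableSet_limInfEqTop r).compl
      (fun w hw => not_congr (G.tail_mem_limInfEqTop_iff r hw)) h) fun c hc => ?_
  let P : V × V → Prop := fun e => G.edge e.1 e.2 ∧ (G.supVal (G.limInfEqTop r)ᶜ e.1).toReal = c
  rcases exists_potential_or_balanced_nonpos (Finset.univ.filter P) G.drift
    (fun e => (r e.1 : ℝ)) with ⟨H, δ, hδ, hH⟩ | ⟨x, hx, hxP, hx0, hxr⟩
  · refine ⟨H, δ, hδ, fun n h hh => ?_⟩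
    have := G.le_nextExp_of_le_moveExp σ (h := h) (f := H) (b := δ + H h.last - r h.last)
      fun u hu => by
        have := hH (h.last, u) (Finset.mem_filter.2 ⟨Finset.mem_univ _, hu, hh⟩)
        rw [sum_drift_mul] at this
        linarith
    linarith
  · obtain ⟨t, u, τ, hP, hτ⟩ := G.exists_strategy_limInfEqTop (P := P) (fun e he => he.1) hx
      (fun e he => hxP e (by simpa using he)) hx0 hxr
    have h1 := G.supVal_eq_one_of_pr_compl_eq_zero τ t (G.measurableSet_limInfEqTop r).compl
      (by rwa [compl_compl])
    exact absurd (h1.symm.trans hP.2) hc.ne'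

theorem pr_mono_objective (r : V → ℤ) :
    G.pr σ s (G.meanPos r) ≤ G.pr σ s (G.limInfEqTop r) :=
  measure_mono (G.meanPos_subset_limInfEqTop r)

/-- The bound for the complements, rewritten by `P(Oᶜ) = 1 - P(O)`. -/
theorem iInf_limInfEqTop_le (r : V → ℤ) :
    ⨅ τ : G.Strategy, G.pr τ s (G.limInfEqTop r) ≤ G.pr σ s (G.meanPos r) := by
  set b := ⨅ τ : G.Strategy, G.pr τ s (G.limInfEqTop r) with hb
  have hb1 : b ≤ 1 := (iInf_le _ σ).trans prob_le_one
  have h1 : G.supVal (G.limInfEqTop r)ᶜ s ≤ 1 - b := iSup_le fun τ => by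
    rw [prob_compl_eq_one_sub (G.measurableSet_limInfEqTop r)]
    exact tsub_le_tsub_left (iInf_le (fun τ : G.Strategy => G.pr τ s (G.limInfEqTop r)) τ) 1
  have h2 := (G.pr_compl_meanPos_le_supVal σ s r).trans h1
  rw [prob_compl_eq_one_sub (G.measurableSet_meanPos r)] at h2
  have h3 := tsub_le_tsub_left h2 1
  rwa [ENNReal.sub_sub_cancel ENNReal.one_ne_top hb1,
    ENNReal.sub_sub_cancel ENNReal.one_ne_top prob_le_one] at h3

theorem val_meanPos_eq_val_limInfEqTop (r : V → ℤ) :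
    G.val (G.meanPos r) s = G.val (G.limInfEqTop r) s := by
  unfold val
  cases G.player
  · exact le_antisymm (iSup_mono fun σ => G.pr_mono_objective σ s r)
      (iSup_le fun σ => G.pr_limInfEqTop_le_supVal σ s r)
  · exact le_antisymm (iInf_mono fun σ => G.pr_mono_objective σ s r)
      (le_iInf fun σ => G.iInf_limInfEqTop_le σ s r)

/-- The Markov chain obtained by fixing a memoryless strategy, seen as an MDP without controlled
states. -/
noncomputable def chain : MDP V where
  player := .max
  edge := G.edge
  exists_edge := G.exists_edge
  controlled := ∅
  prob v _ := G.next σ (n := 0) fun _ => v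
  edge_of_mem_support v _ u hu := G.edge_of_next_ne_zero σ (n := 0) (fun _ => v) u hu

theorem next_eq_of_memoryless (hσ : σ.Memoryless) {n : ℕ} (h : History V n) :
    G.next σ h = G.next σ (n := 0) fun _ => h.last := by
  unfold next
  by_cases hc : h.last ∈ G.controlled
  · rw [dif_pos hc, dif_pos (show History.last (n := 0) (fun _ => h.last) ∈ G.controlled from hc)]
    exact hσ _ _ _ _ _ _ rfl
  · rw [dif_neg hc, dif_neg (show History.last (n := 0) (fun _ => h.last) ∉ G.controlled from hc)]
    rfl

/-- Neither transition law depends on more than the last state, so the step kernels coincide. -/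
theorem pr_chain (hσ : σ.Memoryless) (τ : (G.chain σ).Strategy) :
    (G.chain σ).pr τ s = G.pr σ s := by
  have h : (G.chain σ).stepKernel τ = G.stepKernel σ := by
    funext n
    refine Kernel.ext fun h => ?_
    change ((G.chain σ).next τ h).toMeasure = (G.next σ h).toMeasure
    rw [G.next_eq_of_memoryless σ hσ, next,
      dif_neg (show h.last ∉ (G.chain σ).controlled from Set.notMem_empty _)]
    rfl
  unfold pr
  congr 2

/-- In a finite Markov chain, the accumulated reward almost surely tends to infinity only along
runs of positive mean payoff. -/
theorem pr_meanPos_eq_of_memoryless (hσ : σ.Memoryless) (r : V → ℤ) :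
    G.pr σ s (G.meanPos r) = G.pr σ s (G.limInfEqTop r) := by
  -- With no controlled states a strategy exists vacuously, and all strategies give the same
  -- measure, so the supremum is over a constant.
  let τ : (G.chain σ).Strategy := ⟨fun _ _ h => h.elim, fun _ _ h => h.elim⟩
  refine le_antisymm (G.pr_mono_objective σ s r) ?_
  have h := (G.chain σ).pr_limInfEqTop_le_supVal τ s r
  simp only [supVal, G.pr_chain σ s hσ] at h
  exact h.trans (iSup_le fun _ => le_rfl)

end MDP

theorem mainTheorem4 {V : Type*} [Finite V] [MeasurableSpace V] [DiscreteMeasurableSpace V]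
    (G : MDP V) (r : V → ℤ) (hr : ∀ v, r v = -1 ∨ r v = 0 ∨ r v = 1) :
    (∀ (s : V) (σ : G.Strategy), σ.Memoryless →
      G.pr σ s (G.meanPos r) = G.pr σ s (G.limInfEqTop r)) ∧
    (∀ s : V, G.val (G.meanPos r) s = G.val (G.limInfEqTop r) s) ∧
    (∀ σ : G.Strategy, σ.Memoryless →
      (∀ s : V, G.IsOptimalIn (G.meanPos r) σ s ↔ G.IsOptimalIn (G.limInfEqTop r) σ s) ∧
      (G.IsOptimal (G.meanPos r) σ ↔ G.IsOptimal (G.limInfEqTop r) σ)) ∧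
    (∀ (s : V) (σ : G.Strategy),
      (G.player = Player.max →
        G.IsOptimalIn (G.meanPos r) σ s → G.IsOptimalIn (G.limInfEqTop r) σ s) ∧
      (G.player = Player.min →
        G.IsOptimalIn (G.limInfEqTop r) σ s → G.IsOptimalIn (G.meanPos r) σ s)) := by
  cases nonempty_fintype V
  have h1 : ∀ (s : V) (σ : G.Strategy), σ.Memoryless →
      G.pr σ s (G.meanPos r) = G.pr σ s (G.limInfEqTop r) :=
    fun s σ hσ => G.pr_meanPos_eq_of_memoryless σ s hσ r
  have h2 : ∀ s : V, G.val (G.meanPos r) s = G.val (G.limInfEqTop r) s :=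
    fun s => G.val_meanPos_eq_val_limInfEqTop s r
  have h3 : ∀ σ : G.Strategy, σ.Memoryless → ∀ s : V,
      G.IsOptimalIn (G.meanPos r) σ s ↔ G.IsOptimalIn (G.limInfEqTop r) σ s := by
    intro σ hσ s
    unfold MDP.IsOptimalIn
    rw [h1 s σ hσ, h2 s]
  refine ⟨h1, h2, fun σ hσ => ⟨h3 σ hσ, forall_congr' (h3 σ hσ)⟩, fun s σ => ⟨?_, ?_⟩⟩
  · intro hp h
    unfold MDP.IsOptimalIn at h ⊢
    rw [hp] at h ⊢
    exact (h2 s).ge.trans (h.trans (G.pr_mono_objective σ s r))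
  · intro hp h
    unfold MDP.IsOptimalIn at h ⊢
    rw [hp] at h ⊢
    exact (G.pr_mono_objective σ s r).trans (h.trans (h2 s).ge)
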